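/- For a Dirichlet character $\chi$ modulo $q$ and real $x>0$ consider $\sum_{n\le x}\chi(n)$, the sum over positive integers $n\le x$. The Generalized Riemann Hypothesis (GRH) is the assertion that, for every Dirichlet character $\chi$ modulo every $q\ge 1$, all zeros of $L(s,\chi)$ with $0<\operatorname{Re} s<1$ satisfy $\operatorname{Re} s=\tfrac12$. (i) Assume GRH. Then $\sum_{n\le x}\chi(n)=o(x)$, uniformly over all non-principal characters $\chi$ modulo $q$, whenever $\log x/\log\log q\to\infty$. That is, for every $\varepsilon>0$ there is $K=K(\varepsilon)$ such that for every integer $q\ge 3$, every real $x>0$ with $\log x/\log\log q\ge K$, and every non-principal character $\chi \pmod q$, $$\Bigl|\sum_{n\le x}\chi(n)\Bigr|\le \varepsilon x .$$ (ii) This is sharp, in the following unconditional sense. For every fixed $A>0$ there are a constant $c=c(A)>0$ and an integer $q_0=q_0(A)$ such that for every prime $q\ge q_0$ there is a non-principal character $\chi\pmod q$ with $$\Bigl|\sum_{n\le x}\chi(n)\Bigr|\ge c\,x,\qquad\text{where } x=(\log q)^A .$$ -/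

import Mathlib

/-- The Generalized Riemann Hypothesis for Dirichlet `L`-functions: for every modulus `q ≥ 1` and
every Dirichlet character `χ` mod `q`, every zero of `L(s, χ)` in the open critical strip
`0 < Re s < 1` lies on the line `Re s = 1/2`. (An imprimitive character is allowed: inside the open
strip its `L`-function has the same zeros as that of the primitive character inducing it.) -/
def GeneralizedRiemannHypothesis : Prop :=
  ∀ (q : ℕ) [NeZero q] (χ : DirichletCharacter ℂ q) (s : ℂ),
    DirichletCharacter.LFunction χ s = 0 → 0 < s.re → s.re < 1 → s.re = 1 / 2

/-- The character sum `∑_{1 ≤ n ≤ x} χ(n)`, for real `x`. -/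
noncomputable def charSum {q : ℕ} (χ : DirichletCharacter ℂ q) (x : ℝ) : ℂ :=
  ∑ n ∈ Finset.Icc 1 ⌊x⌋₊, χ (n : ZMod q)

/-! ### Mertens-type estimates for sums of `Λ d / d` -/

section

open Finset ArithmeticFunction

/-! Write `L = log q`.

Under GRH, `L'/L(s, χ)` is `O(log q * (1 + |t|)^(1/2))` on `3/4 ≤ Re s ≤ 2` (Borel–Carathéodory
applied to a logarithm of the L-function, using only a polynomial growth bound). Perron's formula
with the absolutely convergent kernel `z^s / s^2`, shifted to `Re s = 3/4`, shows that the sum of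
`χ(d) Λ(d) log(z/d)` over `d ≤ z` is `O(L z^(3/4))`. Since `log = Λ * 1`, the sum of `χ(n) log n
log(z/n)` over `n ≤ z` splits over `n = d m`. For `m ≤ z / L^4` the GRH bound contributes `O(z)`;
for larger `m` one has `d < L^4`, and the trivial bound with Mertens gives `O(z log L)`. So the
doubly weighted sum is `O(z log log q)` (`norm_sum_char_log_mul_log_le`). Comparing the lengths `x`
and `(1 + η) x` removes one weight, and the other is essentially `log x`; dividing by `log x` gives
a saving once `log x / log log q` is large (`norm_charSum_mul_log_le`).

For sharpness, take high moments. Let `x = L^A` and let `T` be the integers up to `x` with all prime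
factors at most `L`; they have positive density (`exists_mul_le_smoothCount`). Choose `k` of order
`L / log L` with `x^k ≤ q`. Products of `k` elements of `T` are again smooth and at most `q`, so
they take only `exp(O(L / log L)) = exp(O(k))` values (`exists_smoothCount_le_exp`). By Parseval and
Cauchy–Schwarz, these many coincidences make the `2k`-th moment over all characters at least `(q -
1) (#T)^(2k) exp(-O(k))`. The principal character contributes at most `x^(2k)`, smaller by a factor
`q^(1 - o(1))`, so some other character has a sum of order `x`. -/

lemma log_factorial_eq_sum_vonMangoldt (N : ℕ) :
    Real.log (N.factorial) = ∑ d ∈ Ioc 0 N, Λ d * ((N / d : ℕ) : ℝ) := by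
  rw [← sum_Ioc_mul_zeta_eq_sum, vonMangoldt_mul_zeta, ← Finset.prod_Ico_id_eq_factorial,
    show Ico 1 (N + 1) = Ioc 0 N by ext; simp; omega]
  push_cast
  rw [Real.log_prod (fun i hi => by have := (mem_Ioc.1 hi).1; positivity)]
  rfl

/-- Dropping the floors in the formula for `log N!` only increases the sum, so Stirling's lower
bound transfers to it. -/
lemma sum_vonMangoldt_div_ge {N : ℕ} (hN : 1 ≤ N) :
    Real.log N - 1 ≤ ∑ d ∈ Ioc 0 N, Λ d / d := by
  have hN' : (0 : ℝ) < N := by exact_mod_cast hN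
  have h1 : N * Real.log N - N ≤ Real.log N.factorial := by
    have := Stirling.le_log_factorial_stirling (n := N) (by omega)
    have h2 : 0 ≤ Real.log N := Real.log_natCast_nonneg N
    have h3 : 0 ≤ Real.log (2 * Real.pi) := Real.log_nonneg (by linarith [Real.pi_gt_three])
    linarith
  have h2 : Real.log N.factorial ≤ N * ∑ d ∈ Ioc 0 N, Λ d / d := by
    rw [log_factorial_eq_sum_vonMangoldt, mul_sum]
    refine sum_le_sum fun d hd => ?_
    have : ((N / d : ℕ) : ℝ) ≤ (N : ℝ) / d := Nat.cast_div_le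
    calc Λ d * ((N / d : ℕ) : ℝ) ≤ Λ d * ((N : ℝ) / d) :=
          mul_le_mul_of_nonneg_left this vonMangoldt_nonneg
      _ = _ := by ring
  have h3 : N * (Real.log N - 1) ≤ N * ∑ d ∈ Ioc 0 N, Λ d / d := by linarith
  exact le_of_mul_le_mul_left h3 hN'

/-- Restoring the floors costs at most `Λ d` for each `d`, hence `ψ(N)` in total, which Chebyshev's
bound makes `O(N)`. -/
lemma sum_vonMangoldt_div_le {N : ℕ} (hN : 1 ≤ N) :
    ∑ d ∈ Ioc 0 N, Λ d / d ≤ Real.log N + 6 := by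
  have hN' : (0 : ℝ) < N := by exact_mod_cast hN
  have h1 : Real.log N.factorial ≤ N * Real.log N := by
    have : ((N.factorial : ℕ) : ℝ) ≤ (N : ℝ) ^ N := by exact_mod_cast Nat.factorial_le_pow N
    calc _ ≤ Real.log ((N : ℝ) ^ N) :=
          Real.log_le_log (by exact_mod_cast Nat.factorial_pos N) this
      _ = _ := Real.log_pow _ _
  have h2 : N * ∑ d ∈ Ioc 0 N, Λ d / d ≤ Real.log N.factorial + Chebyshev.psi N := by
    rw [log_factorial_eq_sum_vonMangoldt, mul_sum, Chebyshev.psi, Nat.floor_natCast,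
      ← sum_add_distrib]
    refine sum_le_sum fun d hd => ?_
    have h0 : 0 < d := (mem_Ioc.1 hd).1
    have : (N : ℝ) / d ≤ ((N / d : ℕ) : ℝ) + 1 := by
      rw [← Nat.floor_div_eq_div (K := ℝ)]
      exact (Nat.lt_floor_add_one _).le
    calc (N : ℝ) * (Λ d / d) = Λ d * ((N : ℝ) / d) := by ring
      _ ≤ Λ d * (((N / d : ℕ) : ℝ) + 1) := mul_le_mul_of_nonneg_left this vonMangoldt_nonneg
      _ = _ := by ring
  have h3 := Chebyshev.psi_le_const_mul_self hN'.le
  have h4 : Real.log 4 ≤ 2 := by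
    rw [show (4 : ℝ) = 2 ^ 2 by norm_num, Real.log_pow]
    have := Real.log_two_lt_d9
    push_cast; linarith
  have h5 : N * ∑ d ∈ Ioc 0 N, Λ d / d ≤ N * (Real.log N + 6) := by nlinarith
  exact le_of_mul_le_mul_left h5 hN'

lemma sum_Ioc_vonMangoldt_div_ge {D N : ℕ} (hD : 1 ≤ D) (hDN : D ≤ N) :
    Real.log N - Real.log D - 7 ≤ ∑ d ∈ Ioc D N, Λ d / d := by
  have h1 := sum_vonMangoldt_div_ge (hD.trans hDN)
  have h2 := sum_vonMangoldt_div_le hD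
  have h3 := sum_Ioc_consecutive (fun d => Λ d / (d : ℝ)) (Nat.zero_le D) hDN
  linarith

end

/-! ### Positive density of smooth numbers up to a fixed power of the smoothness bound -/

section

open Finset ArithmeticFunction

/-- The number of `Y`-smooth positive integers up to `u`, where smooth means that all prime factors
are less than `Y`. -/
noncomputable def smoothCount (u : ℝ) (Y : ℕ) : ℕ := #(Nat.smoothNumbersUpTo ⌊u⌋₊ Y)

lemma mem_smoothNumbersUpTo_floor {u : ℝ} (hu : 0 ≤ u) {n Y : ℕ} :
    n ∈ Nat.smoothNumbersUpTo ⌊u⌋₊ Y ↔ (n : ℝ) ≤ u ∧ n ∈ Nat.smoothNumbers Y := by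
  rw [Nat.mem_smoothNumbersUpTo, Nat.le_floor_iff hu]

lemma half_le_smoothCount {u : ℝ} {Y : ℕ} (hu : 1 ≤ u) (huY : u < Y) :
    u / 2 ≤ smoothCount u Y := by
  have h1 : Ioc 0 ⌊u⌋₊ ⊆ Nat.smoothNumbersUpTo ⌊u⌋₊ Y := fun n hn => by
    rw [mem_Ioc] at hn
    rw [Nat.mem_smoothNumbersUpTo]
    refine ⟨hn.2, Nat.mem_smoothNumbers_of_lt hn.1 (hn.2.trans_lt ?_)⟩
    exact (Nat.floor_lt (by linarith)).2 huY
  have h2 := card_le_card h1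
  rw [Nat.card_Ioc, Nat.sub_zero] at h2
  have h3 : (1 : ℝ) ≤ ⌊u⌋₊ := by exact_mod_cast Nat.le_floor (by simpa using hu)
  have h4 := Nat.lt_floor_add_one u
  have h5 : (⌊u⌋₊ : ℝ) ≤ smoothCount u Y := by exact_mod_cast h2
  linarith

/-- Multiples of `d` among the smooth numbers up to `u`, for a smooth `d`, correspond to smooth
numbers up to `u / d`. -/
lemma card_smooth_multiples {u : ℝ} (hu : 0 ≤ u) {d Y : ℕ} (hd : d ∈ Nat.smoothNumbers Y) :
    smoothCount (u / d) Y ≤ #{n ∈ Nat.smoothNumbersUpTo ⌊u⌋₊ Y | d ∣ n} := by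
  have hd0 : 0 < d := Nat.pos_of_ne_zero (Nat.ne_zero_of_mem_smoothNumbers hd)
  have hd' : (0 : ℝ) < d := by exact_mod_cast hd0
  refine card_le_card_of_injOn (fun m => d * m) (fun m hm => ?_)
    (fun a _ b _ h => Nat.eq_of_mul_eq_mul_left hd0 h)
  have hm' := (mem_smoothNumbersUpTo_floor (by positivity)).1 (mem_coe.1 hm)
  refine mem_coe.2 (mem_filter.2 ⟨(mem_smoothNumbersUpTo_floor hu).2 ⟨?_, ?_⟩, dvd_mul_right _ _⟩)
  · push_cast
    have := (le_div_iff₀ hd').1 hm'.1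
    linarith
  · exact Nat.mul_mem_smoothNumbers hd hm'.2

/-- Count each smooth `n ≤ u` with weight `log n`, the sum of `Λ d` over `d ∣ n`. Keeping only `D <
d < Y`, where `d` is itself smooth, and exchanging sums gives a recursive inequality in the style of
Buchstab and Hildebrand. -/
lemma sum_vonMangoldt_mul_smoothCount_le {u : ℝ} (hu : 1 ≤ u) {D Y : ℕ} :
    ∑ d ∈ Ioc D (Y - 1), Λ d * smoothCount (u / d) Y ≤ smoothCount u Y * Real.log u := by
  have hu0 : 0 ≤ u := by linarith
  calc ∑ d ∈ Ioc D (Y - 1), Λ d * smoothCount (u / d) Y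
      ≤ ∑ d ∈ Ioc D (Y - 1), Λ d * #{n ∈ Nat.smoothNumbersUpTo ⌊u⌋₊ Y | d ∣ n} := by
        refine sum_le_sum fun d hd => mul_le_mul_of_nonneg_left ?_ vonMangoldt_nonneg
        rw [mem_Ioc] at hd
        exact_mod_cast card_smooth_multiples hu0
          (Nat.mem_smoothNumbers_of_lt (by omega) (by omega))
    _ = ∑ n ∈ Nat.smoothNumbersUpTo ⌊u⌋₊ Y, ∑ d ∈ Ioc D (Y - 1), if d ∣ n then Λ d else 0 := by
        rw [sum_comm]
        refine sum_congr rfl fun d _ => ?_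
        rw [← sum_filter, sum_const, nsmul_eq_mul, mul_comm]
    _ ≤ ∑ n ∈ Nat.smoothNumbersUpTo ⌊u⌋₊ Y, Real.log u := by
        refine sum_le_sum fun n hn => ?_
        have hn' := (mem_smoothNumbersUpTo_floor hu0).1 hn
        have hn0 := Nat.ne_zero_of_mem_smoothNumbers hn'.2
        calc _ ≤ ∑ d ∈ n.divisors, Λ d := by
              rw [← sum_filter]
              refine sum_le_sum_of_subset_of_nonneg (fun d hd => ?_)
                (fun _ _ _ => vonMangoldt_nonneg)
              exact Nat.mem_divisors.2 ⟨(mem_filter.1 hd).2, hn0⟩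
          _ = Real.log n := vonMangoldt_sum
          _ ≤ Real.log u := Real.log_le_log (by exact_mod_cast Nat.pos_of_ne_zero hn0) hn'.1
    _ = _ := by rw [sum_const, nsmul_eq_mul, smoothCount]

lemma sum_Ioc_sqrt_vonMangoldt_div_ge {Y : ℕ} (hY : Real.exp 100 ≤ Y) :
    Real.log Y / 4 ≤ ∑ d ∈ Ioc ⌊√(Y : ℝ)⌋₊ (Y - 1), Λ d / d := by
  have hY0 : (0 : ℝ) < Y := (Real.exp_pos _).trans_le hY
  have hlog : 100 ≤ Real.log Y := (Real.le_log_iff_exp_le hY0).2 hY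
  have hY4 : (4 : ℝ) ≤ Y := by
    have := Real.add_one_le_exp 100
    linarith
  have hYn : 4 ≤ Y := by exact_mod_cast hY4
  have hs2 : 2 ≤ √(Y : ℝ) := Real.le_sqrt_of_sq_le (by linarith)
  have hsq : √(Y : ℝ) * √(Y : ℝ) = Y := Real.mul_self_sqrt hY0.le
  have hD1 : 1 ≤ ⌊√(Y : ℝ)⌋₊ := Nat.le_floor (by push_cast; linarith)
  have hfl : (⌊√(Y : ℝ)⌋₊ : ℝ) ≤ √(Y : ℝ) := Nat.floor_le (by positivity)
  have hcast : ((Y - 1 : ℕ) : ℝ) = Y - 1 := by push_cast [Nat.cast_sub (by omega : 1 ≤ Y)]; ring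
  have hD2 : ⌊√(Y : ℝ)⌋₊ ≤ Y - 1 := by
    have : (⌊√(Y : ℝ)⌋₊ : ℝ) ≤ ((Y - 1 : ℕ) : ℝ) := by rw [hcast]; nlinarith
    exact_mod_cast this
  have h := sum_Ioc_vonMangoldt_div_ge hD1 hD2
  have h1 : Real.log ⌊√(Y : ℝ)⌋₊ ≤ Real.log Y / 2 := by
    rw [← Real.log_sqrt hY0.le]
    exact Real.log_le_log (by exact_mod_cast hD1) hfl
  have h2 : Real.log Y - 1 ≤ Real.log ((Y - 1 : ℕ) : ℝ) := by
    have : Real.log (Y / 2) ≤ Real.log ((Y - 1 : ℕ) : ℝ) :=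
      Real.log_le_log (by positivity) (by rw [hcast]; linarith)
    rw [Real.log_div hY0.ne' (by norm_num)] at this
    linarith [Real.log_two_lt_d9]
  linarith

/-- Smooth numbers have positive density up to any fixed power of the smoothness bound. -/
lemma exists_mul_le_smoothCount (j : ℕ) : ∃ c : ℝ, 0 < c ∧ ∀ Y : ℕ, Real.exp 100 ≤ Y →
    ∀ u : ℝ, 1 ≤ u → u ≤ √(Y : ℝ) ^ j → c * u ≤ smoothCount u Y := by
  have base : ∀ Y : ℕ, Real.exp 100 ≤ Y → ∀ u : ℝ, 1 ≤ u → u < Y →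
      1 / 2 * u ≤ smoothCount u Y := fun Y _ u hu huY => by
    have := half_le_smoothCount hu huY
    linarith
  -- Each step divides `u` by some `d` in `(√Y, Y)`, lowering the exponent of `√Y` by one. The sum
  -- of `Λ d / d` over this range is at least `log Y / 4`, while `log u ≤ (j + 1) log Y / 2`; the
  -- quotient is the loss `1 / (2 (j + 1))`. For `u < Y` every integer up to `u` is smooth.
  induction j with
  | zero =>
    refine ⟨1 / 2, by norm_num, fun Y hY u hu hu' => base Y hY u hu ?_⟩
    have := Real.add_one_le_exp 100
    rw [pow_zero] at hu'
    linarith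
  | succ j ih =>
    obtain ⟨c, hc, ih⟩ := ih
    refine ⟨min (1 / 2) (c / (2 * (j + 1))), by positivity, fun Y hY u hu hu' => ?_⟩
    have hY0 : (0 : ℝ) < Y := (Real.exp_pos _).trans_le hY
    have hlog : 100 ≤ Real.log Y := (Real.le_log_iff_exp_le hY0).2 hY
    have hs0 : 0 < √(Y : ℝ) := Real.sqrt_pos.2 hY0
    rcases lt_or_ge u Y with huY | huY
    · refine le_trans ?_ (base Y hY u hu huY)
      gcongr
      exact min_le_left _ _
    have h1 := sum_vonMangoldt_mul_smoothCount_le hu (D := ⌊√(Y : ℝ)⌋₊) (Y := Y)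
    have h2 : c * u * (Real.log Y / 4) ≤
        ∑ d ∈ Ioc ⌊√(Y : ℝ)⌋₊ (Y - 1), Λ d * smoothCount (u / d) Y := by
      calc c * u * (Real.log Y / 4) ≤ c * u * ∑ d ∈ Ioc ⌊√(Y : ℝ)⌋₊ (Y - 1), Λ d / d := by
            gcongr
            exact sum_Ioc_sqrt_vonMangoldt_div_ge hY
        _ = ∑ d ∈ Ioc ⌊√(Y : ℝ)⌋₊ (Y - 1), Λ d * (c * (u / d)) := by
            rw [mul_sum]
            exact sum_congr rfl fun d _ => by ring
        _ ≤ _ := by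
            refine sum_le_sum fun d hd => mul_le_mul_of_nonneg_left ?_ vonMangoldt_nonneg
            rw [mem_Ioc] at hd
            have hd1 : √(Y : ℝ) ≤ d := ((Nat.floor_lt hs0.le).1 hd.1).le
            have hd0 : (0 : ℝ) < d := hs0.trans_le hd1
            refine ih Y hY _ ?_ ?_
            · rw [le_div_iff₀ hd0, one_mul]
              refine le_trans ?_ huY
              exact_mod_cast hd.2.trans (Nat.sub_le _ _)
            · rw [div_le_iff₀ hd0]
              calc u ≤ √(Y : ℝ) ^ j * √(Y : ℝ) := by rwa [← pow_succ]
                _ ≤ _ := by gcongr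
    have h3 : Real.log u ≤ (j + 1) * (Real.log Y / 2) := by
      rw [← Real.log_sqrt hY0.le]
      calc Real.log u ≤ Real.log (√(Y : ℝ) ^ (j + 1)) := Real.log_le_log (by linarith) hu'
        _ = _ := by rw [Real.log_pow]; push_cast; ring
    have h4 : c * u * (Real.log Y / 4) ≤ smoothCount u Y * ((j + 1) * (Real.log Y / 2)) :=
      h2.trans (h1.trans (by gcongr))
    have h5 : c / (2 * (j + 1)) * u ≤ smoothCount u Y := by
      rw [div_mul_eq_mul_div, div_le_iff₀ (by positivity)]
      have : (c * u) * (Real.log Y / 4) ≤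
          (smoothCount u Y * (2 * (j + 1))) * (Real.log Y / 4) := by linarith
      exact le_of_mul_le_mul_right this (by linarith)
    refine le_trans ?_ h5
    gcongr
    exact min_le_right _ _

end

/-! ### Rankin's upper bound for smooth numbers -/

section

open Finset Filter

/-- The completely multiplicative function `n ↦ n ^ (-α)`, for `α > 0`. -/
noncomputable def natRpowNegHom (α : ℝ) : ℕ →* ℝ where
  toFun n := (n : ℝ) ^ (-α)
  map_one' := by simp
  map_mul' m n := by
    push_cast
    exact Real.mul_rpow (by positivity) (by positivity)

lemma natRpowNegHom_apply (α : ℝ) (n : ℕ) : natRpowNegHom α n = (n : ℝ) ^ (-α) := rfl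

lemma natRpowNegHom_prime_lt_one {α : ℝ} (hα : 0 < α) {p : ℕ} (hp : p.Prime) :
    ‖natRpowNegHom α p‖ < 1 := by
  have h1 : (1 : ℝ) < p := by exact_mod_cast hp.one_lt
  rw [natRpowNegHom_apply, Real.norm_of_nonneg (by positivity)]
  exact Real.rpow_lt_one_of_one_lt_of_neg h1 (by linarith)

/-- Rankin's upper bound for the number of smooth integers. -/
lemma smoothCount_le_rankin {α : ℝ} (hα : 0 < α) {u : ℝ} (hu : 0 ≤ u) (Y : ℕ) :
    (smoothCount u Y : ℝ) ≤ u ^ α * ∏ p ∈ Y.primesBelow, (1 - (p : ℝ) ^ (-α))⁻¹ := by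
  obtain ⟨hsum, hprod⟩ :=
    EulerProduct.summable_and_hasSum_smoothNumbers_prod_primesBelow_geometric
      (f := natRpowNegHom α) (natRpowNegHom_prime_lt_one hα) Y
  have hmem : ∀ n ∈ Nat.smoothNumbersUpTo ⌊u⌋₊ Y, n ∈ Nat.smoothNumbers Y := fun n hn =>
    (Nat.mem_smoothNumbersUpTo.1 hn).2
  have h1 : ∑ n ∈ Nat.smoothNumbersUpTo ⌊u⌋₊ Y, natRpowNegHom α n ≤
      ∏ p ∈ Y.primesBelow, (1 - natRpowNegHom α p)⁻¹ := by
    have := sum_le_hasSum ((Nat.smoothNumbersUpTo ⌊u⌋₊ Y).subtype (· ∈ Nat.smoothNumbers Y))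
      (fun n _ => by rw [natRpowNegHom_apply]; positivity) hprod
    refine le_trans (le_of_eq ?_) this
    rw [sum_subtype_of_mem _ hmem]
  simp only [natRpowNegHom_apply] at h1
  have h2 : (smoothCount u Y : ℝ) ≤
      u ^ α * ∑ n ∈ Nat.smoothNumbersUpTo ⌊u⌋₊ Y, (n : ℝ) ^ (-α) := by
    rw [smoothCount, mul_sum, card_eq_sum_ones]
    push_cast
    refine sum_le_sum fun n hn => ?_
    obtain ⟨hn1, hn2⟩ := (mem_smoothNumbersUpTo_floor hu).1 hn
    have hn0 : (0 : ℝ) < n := by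
      exact_mod_cast Nat.pos_of_ne_zero (Nat.ne_zero_of_mem_smoothNumbers hn2)
    rw [Real.rpow_neg hn0.le, ← div_eq_mul_inv, ← Real.div_rpow hu hn0.le]
    exact Real.one_le_rpow ((one_le_div hn0).2 hn1) hα.le
  exact h2.trans (mul_le_mul_of_nonneg_left h1 (by positivity))

/-- With `t = log p / L` in `(0, 1]` this is the inequality `1 - exp(-t) ≥ t / 2`. -/
lemma inv_one_sub_rpow_neg_inv_log_le {p L : ℝ} (hp : 1 < p) (hL : Real.log p ≤ L) :
    (1 - p ^ (-(1 / L)))⁻¹ ≤ 2 * L / Real.log p := by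
  have hlp : 0 < Real.log p := Real.log_pos hp
  have hL0 : 0 < L := hlp.trans_le hL
  set t := Real.log p / L with ht
  have ht0 : 0 < t := by positivity
  have ht1 : t ≤ 1 := (div_le_one hL0).2 hL
  have h1 : p ^ (-(1 / L)) = Real.exp (-t) := by
    rw [Real.rpow_def_of_pos (by linarith), ht]
    congr 1
    ring
  have h2 : Real.exp (-t) ≤ 1 - t / 2 := by
    rw [Real.exp_neg, inv_le_comm₀ (Real.exp_pos _) (by linarith)]
    calc (1 - t / 2)⁻¹ ≤ 1 + t := by
          rw [inv_le_comm₀ (by linarith) (by linarith), inv_le_iff_one_le_mul₀ (by linarith)]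
          nlinarith
      _ ≤ Real.exp t := by linarith [Real.add_one_le_exp t]
  rw [h1]
  calc (1 - Real.exp (-t))⁻¹ ≤ (t / 2)⁻¹ := by
        apply inv_anti₀ (by positivity)
        linarith
    _ = _ := by rw [ht]; field_simp

/-- A prime above `√Y` has `log p ≥ log Y / 2`, so its Euler factor is at most `4`. The at most `√Y`
smaller primes are each allowed a further factor `4 log Y`. -/
lemma prod_primesBelow_le {Y : ℕ} (hY : 3 ≤ Y) :
    ∏ p ∈ Y.primesBelow, (1 - (p : ℝ) ^ (-(1 / Real.log Y)))⁻¹ ≤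
      4 ^ (Nat.primeCounting Y) * (4 * Real.log Y) ^ (√(Y : ℝ)) := by
  have hY0 : (3 : ℝ) ≤ Y := by exact_mod_cast hY
  have hL1 : 1 ≤ Real.log Y := (Real.le_log_iff_exp_le (by linarith)).2
    (by linarith [Real.exp_one_lt_d9])
  have hb : ∀ p ∈ Y.primesBelow, (1 - (p : ℝ) ^ (-(1 / Real.log Y)))⁻¹ ≤
      4 * (if (p : ℝ) ≤ √(Y : ℝ) then 4 * Real.log Y else 1) := fun p hp => by
    obtain ⟨hpY, hpp⟩ := Nat.mem_primesBelow.1 hp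
    have hp2 : (2 : ℝ) ≤ p := by exact_mod_cast hpp.two_le
    have hlp : 1 / 2 ≤ Real.log p := by
      have := Real.log_le_log (by norm_num) hp2
      linarith [Real.log_two_gt_d9]
    refine (inv_one_sub_rpow_neg_inv_log_le (by linarith)
      (Real.log_le_log (by linarith) (by exact_mod_cast hpY.le))).trans ?_
    split_ifs with h
    · rw [div_le_iff₀ (by linarith)]
      nlinarith
    · have : Real.log Y / 2 ≤ Real.log p := by
        rw [← Real.log_sqrt (by linarith)]
        exact Real.log_le_log (by positivity) (not_le.1 h).le
      rw [div_le_iff₀ (by linarith)]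
      linarith
  have hpos : ∀ p ∈ Y.primesBelow, 0 ≤ (1 - (p : ℝ) ^ (-(1 / Real.log Y)))⁻¹ := fun p hp => by
    obtain ⟨hpY, hpp⟩ := Nat.mem_primesBelow.1 hp
    have hp1 : (1 : ℝ) < p := by exact_mod_cast hpp.one_lt
    rw [inv_nonneg, sub_nonneg]
    exact (Real.rpow_lt_one_of_one_lt_of_neg hp1 (by simp; linarith)).le
  refine (prod_le_prod hpos hb).trans ?_
  rw [prod_mul_distrib, prod_const, ← prod_filter, prod_const]
  gcongr
  · norm_num
  · rw [Nat.primesBelow_card_eq_primeCounting']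
    exact Nat.monotone_primeCounting' (Nat.le_succ Y)
  · rw [← Real.rpow_natCast]
    refine Real.rpow_le_rpow_of_exponent_le (by linarith) ?_
    have h1 : Y.primesBelow.filter (fun p : ℕ => (p : ℝ) ≤ √(Y : ℝ)) ⊆ Ioc 0 ⌊√(Y : ℝ)⌋₊ := fun p hp => by
      obtain ⟨hp1, hp2⟩ := mem_filter.1 hp
      exact mem_Ioc.2 ⟨(Nat.prime_of_mem_primesBelow hp1).pos, Nat.le_floor hp2⟩
    have h2 := card_le_card h1
    rw [Nat.card_Ioc, Nat.sub_zero] at h2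
    exact (Nat.cast_le.2 h2).trans (Nat.floor_le (by positivity))

/-- There are at most `exp (C * Y / log Y)` smooth numbers with smoothness bound `Y` up to
`exp Y`. -/
lemma exists_smoothCount_le_exp : ∃ C : ℝ, 0 < C ∧ ∀ᶠ Y : ℕ in atTop, ∀ u : ℝ, 0 < u →
    u ≤ Real.exp Y → (smoothCount u Y : ℝ) ≤ Real.exp (C * (Y / Real.log Y)) := by
  -- Rankin's exponent is `1 / log Y`. The three summands pay for `u^(1 / log Y)`, for the factor
  -- `4` at each of the `O(Y / log Y)` primes, and for the extra factors at primes up to `√Y`.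
  refine ⟨1 + 6 + 1, by norm_num, ?_⟩
  have hpi := tendsto_natCast_atTop_atTop.eventually
    (Chebyshev.eventually_primeCounting_le (ε := 1) one_pos)
  have hsq : ∀ᶠ Y : ℝ in atTop, √Y * Real.log (4 * Real.log Y) ≤ Y / Real.log Y := by
    have h1 : ∀ᶠ Y : ℝ in atTop, Real.log Y ≤ Y ^ (1 / 8 : ℝ) := by
      filter_upwards [(isLittleO_log_rpow_atTop (r := 1 / 8) (by norm_num)).bound one_pos,
        eventually_ge_atTop 1] with Y h hY
      rw [one_mul, Real.norm_of_nonneg (Real.log_nonneg hY), Real.norm_of_nonneg (by positivity)]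
        at h
      exact h
    filter_upwards [h1, eventually_ge_atTop (4 ^ 8), eventually_ge_atTop (Real.exp 1)]
      with Y h hY hYe
    have hY0 : 0 < Y := by linarith
    have hL1 : 1 ≤ Real.log Y := (Real.le_log_iff_exp_le hY0).2 hYe
    have h2 : Real.log (4 * Real.log Y) ≤ 4 * Real.log Y := by
      have := Real.log_le_sub_one_of_pos (show 0 < 4 * Real.log Y by linarith)
      linarith
    have h4 : 4 ≤ Y ^ (1 / 8 : ℝ) := by
      calc (4 : ℝ) = ((4 : ℝ) ^ (8 : ℕ)) ^ (1 / 8 : ℝ) := by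
            rw [← Real.rpow_natCast, ← Real.rpow_mul (by norm_num)]; norm_num
        _ ≤ _ := by gcongr
    set r := Y ^ (1 / 8 : ℝ) with hr
    have hr0 : 0 < r := by positivity
    have hYr : Y = r ^ 8 := by
      rw [hr, ← Real.rpow_natCast, ← Real.rpow_mul hY0.le]; norm_num
    have hsr : √Y = r ^ 4 := by
      rw [hYr, show r ^ 8 = (r ^ 4) ^ 2 by ring, Real.sqrt_sq (by positivity)]
    rw [le_div_iff₀ (by linarith), hsr]
    calc r ^ 4 * Real.log (4 * Real.log Y) * Real.log Y ≤ r ^ 4 * (4 * r) * r := by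
          gcongr
          · exact h2.trans (by linarith)
      _ ≤ r ^ 4 * (r * r) * r := by gcongr
      _ ≤ r ^ 4 * (r * r) * r * r := le_mul_of_one_le_right (by positivity) (by linarith)
      _ = Y := by rw [hYr]; ring
  filter_upwards [hpi, tendsto_natCast_atTop_atTop.eventually hsq, eventually_ge_atTop 3]
    with Y hpi hsq hY u hu huY
  have hY0 : (3 : ℝ) ≤ Y := by exact_mod_cast hY
  have hL1 : 1 ≤ Real.log Y := (Real.le_log_iff_exp_le (by linarith)).2
    (by linarith [Real.exp_one_lt_d9])
  rw [Nat.floor_natCast] at hpi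
  have hl4 : Real.log 4 ≤ 3 / 2 := by
    rw [show (4 : ℝ) = 2 ^ 2 by norm_num, Real.log_pow]
    have := Real.log_two_lt_d9
    push_cast; linarith
  have hl40 : 0 ≤ Real.log 4 := Real.log_nonneg (by norm_num)
  have hYL : 0 ≤ (Y : ℝ) / Real.log Y := by positivity
  refine (smoothCount_le_rankin (α := 1 / Real.log Y) (by positivity) hu.le Y).trans ?_
  have h1 : u ^ (1 / Real.log Y) ≤ Real.exp (Y / Real.log Y) := by
    rw [Real.rpow_def_of_pos hu]
    gcongr
    rw [mul_one_div]
    gcongr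
    exact (Real.log_le_iff_le_exp hu).2 huY
  have h2 : (4 : ℝ) ^ (Nat.primeCounting Y) ≤ Real.exp (6 * (Y / Real.log Y)) := by
    rw [← Real.rpow_natCast, Real.rpow_def_of_pos (by norm_num), Real.exp_le_exp]
    calc Real.log 4 * (Nat.primeCounting Y : ℝ)
        ≤ (3 / 2) * ((Real.log 4 + 1) * Y / Real.log Y) := by gcongr
      _ = (3 / 2) * (Real.log 4 + 1) * (Y / Real.log Y) := by ring
      _ ≤ _ := by gcongr; linarith
  have h3 : (4 * Real.log Y) ^ (√(Y : ℝ)) ≤ Real.exp (Y / Real.log Y) := by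
    rw [Real.rpow_def_of_pos (by linarith)]
    gcongr
    linarith
  calc _ ≤ Real.exp (Y / Real.log Y) * (Real.exp (6 * (Y / Real.log Y)) *
        Real.exp (Y / Real.log Y)) := by
        refine mul_le_mul h1 ((prod_primesBelow_le hY).trans (mul_le_mul h2 h3 ?_ ?_)) ?_ ?_
        any_goals positivity
        refine prod_nonneg fun p hp => ?_
        have hp1 : (1 : ℝ) < p := by exact_mod_cast (Nat.prime_of_mem_primesBelow hp).one_lt
        rw [inv_nonneg, sub_nonneg]
        exact (Real.rpow_lt_one_of_one_lt_of_neg hp1 (by simp; linarith)).le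
    _ = _ := by rw [← Real.exp_add, ← Real.exp_add]; congr 1; ring

end

/-! ### Moments of character sums to a prime modulus -/

section

open Finset Filter

/-- Parseval's identity for Dirichlet characters to a prime modulus. -/
lemma sum_norm_sq_sum_char {q : ℕ} [Fact q.Prime] {ι : Type*} (P : Finset ι) (F : ι → ZMod q)
    (hF : ∀ t ∈ P, F t ≠ 0) :
    ∑ χ : DirichletCharacter ℂ q, ‖∑ t ∈ P, χ (F t)‖ ^ 2 =
      ((q : ℝ) - 1) * ∑ t ∈ P, (#{t' ∈ P | F t = F t'} : ℝ) := by
  have hq : ((q.totient : ℕ) : ℂ) = (q : ℂ) - 1 := by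
    rw [Nat.totient_prime Fact.out, Nat.cast_sub (Nat.Prime.one_le Fact.out), Nat.cast_one]
  have h : ∀ χ : DirichletCharacter ℂ q, ((‖∑ t ∈ P, χ (F t)‖ ^ 2 : ℝ) : ℂ) =
      ∑ t ∈ P, ∑ t' ∈ P, χ (F t)⁻¹ * χ (F t') := fun χ => by
    rw [Complex.ofReal_pow, ← Complex.conj_mul', map_sum, sum_mul]
    refine sum_congr rfl fun t _ => ?_
    rw [mul_sum]
    refine sum_congr rfl fun t' _ => ?_
    rw [← MulChar.inv_apply', ← MulChar.star_apply' χ (F t)]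
    rfl
  apply Complex.ofReal_injective
  rw [Complex.ofReal_sum, sum_congr rfl fun χ _ => h χ, sum_comm]
  push_cast
  rw [mul_sum]
  refine sum_congr rfl fun t ht => ?_
  rw [sum_comm, sum_congr rfl fun t' _ =>
    DirichletCharacter.sum_char_inv_mul_char_eq ℂ (isUnit_iff_ne_zero.2 (hF t ht)) (F t'),
    ← sum_filter, sum_const, nsmul_eq_mul, hq, mul_comm]

/-- Cauchy–Schwarz lower bound for the number of coincidences of a map. -/
lemma card_sq_le_card_image_mul {ι κ : Type*} [DecidableEq κ] (P : Finset ι) (F : ι → κ) :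
    #P ^ 2 ≤ #(P.image F) * ∑ t ∈ P, #{t' ∈ P | F t = F t'} := by
  have h1 : ∑ t ∈ P, #{t' ∈ P | F t = F t'} = ∑ v ∈ P.image F, #{t ∈ P | F t = v} ^ 2 := by
    rw [sum_comp (fun v => #{t' ∈ P | v = F t'}) F]
    refine sum_congr rfl fun v _ => ?_
    simp only [eq_comm (a := v), smul_eq_mul, sq]
  rw [h1, card_eq_sum_card_image F P]
  exact sq_sum_le_card_mul_sum_sq

/-- The `k`-th power of the character sum is a sum over `k`-tuples of `χ` of their product, so
Parseval counts pairs of tuples with congruent products. Discarding tuples outside `T` only loses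
pairs, and the remaining products take at most `#B` values, so Cauchy–Schwarz forces many
coincidences. -/
lemma charSum_moment_ge {q : ℕ} [Fact q.Prime] {x : ℝ} (hx : 0 ≤ x) (hxq : x < q)
    {T : Finset ℕ} (hT : T ⊆ Icc 1 ⌊x⌋₊) (k : ℕ) {B : Finset ℕ}
    (hB : ∀ t ∈ Fintype.piFinset (fun _ : Fin k => T), ∏ i, t i ∈ B) :
    ((q : ℝ) - 1) * (#T : ℝ) ^ (2 * k) ≤
      #B * ∑ χ : DirichletCharacter ℂ q, ‖charSum χ x‖ ^ (2 * k) := by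
  classical
  have hq1 : (1 : ℝ) ≤ q := by exact_mod_cast (Nat.Prime.one_le Fact.out : 1 ≤ q)
  set P := Fintype.piFinset (fun _ : Fin k => Icc 1 ⌊x⌋₊) with hP
  set Q := Fintype.piFinset (fun _ : Fin k => T) with hQ
  have hQP : Q ⊆ P := Fintype.piFinset_subset _ _ fun _ => hT
  let F : (Fin k → ℕ) → ZMod q := fun t => ((∏ i, t i : ℕ) : ZMod q)
  -- Since `x < q` and `q` is prime, no entry of a tuple, hence no product, is divisible by `q`.
  have hF : ∀ t ∈ P, F t ≠ 0 := fun t ht => by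
    simp only [F, Nat.cast_prod]
    refine prod_ne_zero_iff.2 fun i _ => ?_
    have := mem_Icc.1 (Fintype.mem_piFinset.1 ht i)
    rw [Ne, ZMod.natCast_eq_zero_iff]
    refine Nat.not_dvd_of_pos_of_lt (by omega) ?_
    exact this.2.trans_lt ((Nat.floor_lt hx).2 hxq)
  have h1 : ∀ χ : DirichletCharacter ℂ q, ‖charSum χ x‖ ^ (2 * k) = ‖∑ t ∈ P, χ (F t)‖ ^ 2 :=
    fun χ => by
      rw [mul_comm, pow_mul, ← norm_pow, charSum, sum_pow']
      congr 2
      refine sum_congr rfl fun t _ => ?_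
      simp [F]
  rw [sum_congr rfl fun χ _ => h1 χ, sum_norm_sq_sum_char P F hF]
  have h2 : ∑ t ∈ Q, #{t' ∈ Q | F t = F t'} ≤ ∑ t ∈ P, #{t' ∈ P | F t = F t'} :=
    (sum_le_sum_of_subset hQP).trans' (sum_le_sum fun t _ =>
      card_le_card (filter_subset_filter _ hQP))
  have h3 : #(Q.image F) ≤ #B := by
    calc #(Q.image F) = #((Q.image fun t => ∏ i, t i).image fun n : ℕ => (n : ZMod q)) := by
          rw [image_image]; rfl
      _ ≤ #(Q.image fun t => ∏ i, t i) := card_image_le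
      _ ≤ #B := card_le_card (image_subset_iff.2 hB)
  have h4 : #T ^ (2 * k) ≤ #B * ∑ t ∈ P, #{t' ∈ P | F t = F t'} := by
    calc #T ^ (2 * k) = #Q ^ 2 := by
          rw [hQ, Fintype.card_piFinset_const, ← pow_mul, mul_comm]
      _ ≤ _ := (card_sq_le_card_image_mul Q F).trans (Nat.mul_le_mul h3 h2)
  have h5 : (#T : ℝ) ^ (2 * k) ≤ #B * ∑ t ∈ P, (#{t' ∈ P | F t = F t'} : ℝ) := by
    exact_mod_cast h4
  calc _ ≤ ((q : ℝ) - 1) * (#B * ∑ t ∈ P, (#{t' ∈ P | F t = F t'} : ℝ)) := by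
        gcongr
    _ = _ := by ring

lemma norm_charSum_le {q : ℕ} (χ : DirichletCharacter ℂ q) {x : ℝ} (hx : 0 ≤ x) :
    ‖charSum χ x‖ ≤ x := by
  calc ‖charSum χ x‖ ≤ ∑ n ∈ Icc 1 ⌊x⌋₊, ‖χ (n : ZMod q)‖ := norm_sum_le _ _
    _ ≤ ∑ n ∈ Icc 1 ⌊x⌋₊, (1 : ℝ) := sum_le_sum fun n _ => χ.norm_le_one _
    _ = ⌊x⌋₊ := by simp
    _ ≤ x := Nat.floor_le hx

lemma charSum_moment_le {q : ℕ} [Fact q.Prime] {x M : ℝ} (hx : 0 ≤ x)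
    (hM : ∀ χ : DirichletCharacter ℂ q, χ ≠ 1 → ‖charSum χ x‖ ≤ M) (hM0 : 0 ≤ M) (k : ℕ) :
    ∑ χ : DirichletCharacter ℂ q, ‖charSum χ x‖ ^ (2 * k) ≤
      x ^ (2 * k) + ((q : ℝ) - 1) * M ^ (2 * k) := by
  classical
  have hcard : (#(univ : Finset (DirichletCharacter ℂ q)) : ℝ) = (q : ℝ) - 1 := by
    rw [card_univ, ← Nat.card_eq_fintype_card,
      DirichletCharacter.card_eq_totient_of_hasEnoughRootsOfUnity, Nat.totient_prime Fact.out,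
      Nat.cast_sub (Nat.Prime.one_le Fact.out), Nat.cast_one]
  rw [← add_sum_erase _ _ (mem_univ (1 : DirichletCharacter ℂ q))]
  refine add_le_add (pow_le_pow_left₀ (norm_nonneg _) (norm_charSum_le _ hx) _) ?_
  calc _ ≤ ∑ χ ∈ univ.erase (1 : DirichletCharacter ℂ q), M ^ (2 * k) :=
        sum_le_sum fun χ hχ => pow_le_pow_left₀ (norm_nonneg _) (hM χ (ne_of_mem_erase hχ)) _
    _ ≤ ∑ χ : DirichletCharacter ℂ q, M ^ (2 * k) :=
        sum_le_sum_of_subset_of_nonneg (erase_subset _ _) fun _ _ _ => by positivity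
    _ = _ := by rw [sum_const, nsmul_eq_mul, hcard]

end

/-! ### Large character sums of length `(log q)^A` -/

section

open Finset Filter

/-- If all non-principal character sums were small, the moment bounds would limit the modulus. -/
lemma sub_one_le_of_charSum_small {q : ℕ} [Fact q.Prime] {x b c₀ Ψ δ : ℝ} (hx : 0 < x)
    (hxq : x < q) {T B : Finset ℕ} (hT : T ⊆ Icc 1 ⌊x⌋₊) {k : ℕ}
    (hB : ∀ t ∈ Fintype.piFinset (fun _ : Fin k => T), ∏ i, t i ∈ B)
    (hΨ : (#B : ℝ) ≤ Ψ) (hc₀ : c₀ = Real.exp (-b)) (hTx : c₀ * x ≤ #T)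
    (hM : ∀ χ : DirichletCharacter ℂ q, χ ≠ 1 → ‖charSum χ x‖ ≤ c₀ * Real.exp (-δ) * x)
    (hδ : Ψ * Real.exp (-(2 * k * δ)) ≤ 1 / 2) :
    ((q : ℝ) - 1) / 2 ≤ Ψ * Real.exp (2 * k * b) := by
  have hq1 : (1 : ℝ) ≤ q := by exact_mod_cast (Nat.Prime.one_le Fact.out : 1 ≤ q)
  have hc0 : 0 < c₀ := hc₀ ▸ Real.exp_pos _
  have hΨ0 : 0 ≤ Ψ := (Nat.cast_nonneg _).trans hΨ
  have h1 := charSum_moment_ge hx.le hxq hT k hB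
  have h2 := charSum_moment_le hx.le hM (by positivity) k
  have h3 : ((q : ℝ) - 1) * (c₀ * x) ^ (2 * k) ≤
      Ψ * (x ^ (2 * k) + ((q : ℝ) - 1) * (c₀ * Real.exp (-δ) * x) ^ (2 * k)) := by
    refine le_trans ?_ (h1.trans ?_)
    · have : 0 ≤ (q : ℝ) - 1 := by linarith
      gcongr
    · gcongr
  have h4 : Real.exp (-δ) ^ (2 * k) = Real.exp (-(2 * k * δ)) := by
    rw [← Real.exp_nat_mul]; congr 1; push_cast; ring
  rw [mul_pow, mul_pow, mul_pow, h4] at h3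
  have hxk : 0 < x ^ (2 * k) := by positivity
  have h5 : ((q : ℝ) - 1) * c₀ ^ (2 * k) ≤
      Ψ + ((q : ℝ) - 1) * c₀ ^ (2 * k) * (Ψ * Real.exp (-(2 * k * δ))) := by
    refine le_of_mul_le_mul_right ?_ hxk
    linarith
  have hck : 0 < c₀ ^ (2 * k) := by positivity
  -- By `hδ` the non-principal characters account for at most half of the left side; the principal
  -- one must supply the rest.
  have h6 : ((q : ℝ) - 1) * c₀ ^ (2 * k) / 2 ≤ Ψ := by
    have : ((q : ℝ) - 1) * c₀ ^ (2 * k) * (Ψ * Real.exp (-(2 * k * δ))) ≤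
        ((q : ℝ) - 1) * c₀ ^ (2 * k) * (1 / 2) :=
      mul_le_mul_of_nonneg_left hδ (mul_nonneg (by linarith) hck.le)
    linarith
  have h7 : c₀ ^ (2 * k) * Real.exp (2 * k * b) = 1 := by
    rw [hc₀, ← Real.exp_nat_mul, ← Real.exp_add, Real.exp_eq_one_iff]
    push_cast; ring
  calc ((q : ℝ) - 1) / 2 = ((q : ℝ) - 1) * c₀ ^ (2 * k) / 2 * Real.exp (2 * k * b) := by
        rw [show ((q : ℝ) - 1) * c₀ ^ (2 * k) / 2 * Real.exp (2 * k * b) =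
          ((q : ℝ) - 1) / 2 * (c₀ ^ (2 * k) * Real.exp (2 * k * b)) by ring, h7, mul_one]
    _ ≤ _ := by gcongr

lemma prod_mem_smoothNumbersUpTo {x u : ℝ} (hx : 0 ≤ x) {Y k : ℕ} (hu : x ^ k ≤ u)
    {t : Fin k → ℕ} (ht : t ∈ Fintype.piFinset fun _ => Nat.smoothNumbersUpTo ⌊x⌋₊ Y) :
    ∏ i, t i ∈ Nat.smoothNumbersUpTo ⌊u⌋₊ Y := by
  have ht' := fun i => (mem_smoothNumbersUpTo_floor hx).1 (Fintype.mem_piFinset.1 ht i)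
  rw [mem_smoothNumbersUpTo_floor ((pow_nonneg hx k).trans hu)]
  constructor
  · push_cast
    refine le_trans ?_ hu
    calc ∏ i, (t i : ℝ) ≤ ∏ _i : Fin k, x := prod_le_prod (fun _ _ => by positivity)
          fun i _ => (ht' i).1
      _ = x ^ k := by simp
  · exact prod_induction _ (· ∈ Nat.smoothNumbers Y) (fun _ _ => Nat.mul_mem_smoothNumbers)
      ⟨one_ne_zero, by simp⟩ fun i _ => (ht' i).2

set_option maxHeartbeats 800000 in
/-- For prime moduli `q`, some non-principal character has sums of length `(log q) ^ A` that are
as large as possible, up to a constant. -/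
theorem exists_large_charSum {A : ℝ} (hA : 0 < A) : ∃ c : ℝ, 0 < c ∧ ∃ q₀ : ℕ, ∀ q : ℕ,
    q.Prime → q₀ ≤ q → ∃ χ : DirichletCharacter ℂ q, χ ≠ 1 ∧
      c * Real.log q ^ A ≤ ‖charSum χ (Real.log q ^ A)‖ := by
  -- The density lemma counts powers of `√Y`, so `2 * ⌈A⌉₊` of them reach `Y ^ ⌈A⌉₊`, which is at
  -- least `x`.
  obtain ⟨c₁, hc₁, hlow⟩ := exists_mul_le_smoothCount (2 * ⌈A⌉₊)
  obtain ⟨C, hC, hup⟩ := exists_smoothCount_le_exp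
  set c₀ := min c₁ 1 with hc₀
  have hc₀0 : 0 < c₀ := by positivity
  set b := -Real.log c₀ with hb
  have hb0 : 0 ≤ b := neg_nonneg.2 (Real.log_nonpos hc₀0.le (min_le_right _ _))
  have hc₀b : c₀ = Real.exp (-b) := by rw [hb, neg_neg, Real.exp_log hc₀0]
  -- With `D = L / log L` and `k ≥ D / (4A)`, one gets `2kδ ≥ (2C + 1) D`, which beats the count
  -- `exp(2CD)` of products by a factor `exp(D)`.
  set δ := 2 * A * (2 * C + 1) with hδ
  -- The final upper bound for `(q - 1) / 2` has exponent at most `M D`, and `2M ≤ log L` makes this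
  -- at most `L / 2`, contradicting `q = exp L`.
  set M := 2 * C + b / A with hM
  have hM0 : 0 < M := by positivity
  refine ⟨c₀ * Real.exp (-δ), by positivity, ?_⟩
  have hlogq : Tendsto (fun q : ℕ => Real.log q) atTop atTop :=
    Real.tendsto_log_atTop.comp tendsto_natCast_atTop_atTop
  have hY : Tendsto (fun q : ℕ => ⌊Real.log q⌋₊ + 1) atTop atTop :=
    (tendsto_add_atTop_nat 1).comp (tendsto_nat_floor_atTop.comp hlogq)
  have e1 : ∀ᶠ L : ℝ in atTop, 1 ≤ Real.log L ∧ 2 * M ≤ Real.log L :=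
    (Real.tendsto_log_atTop.eventually_ge_atTop 1).and
      (Real.tendsto_log_atTop.eventually_ge_atTop (2 * M))
  have e2 : ∀ᶠ L : ℝ in atTop, (4 * A + 1) * Real.log L ≤ L := by
    filter_upwards [Real.isLittleO_log_id_atTop.bound (show 0 < (4 * A + 1)⁻¹ by positivity),
      eventually_ge_atTop 1] with L h hL
    rw [Real.norm_of_nonneg (Real.log_nonneg hL), id, Real.norm_of_nonneg (by linarith)] at h
    rwa [← le_inv_mul_iff₀ (by positivity)]
  obtain ⟨q₀, hq₀⟩ := eventually_atTop.1 ((hY.eventually hup).and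
    ((hlogq.eventually (e1.and (e2.and (eventually_ge_atTop (Real.exp 100))))).and
      (eventually_ge_atTop 3)))
  refine ⟨q₀, fun q hqp hq => ?_⟩
  obtain ⟨hup, ⟨⟨hℓ1, hℓM⟩, hLA, hL100⟩, hq3⟩ := hq₀ q hq
  have : Fact q.Prime := ⟨hqp⟩
  by_contra! hcon
  have hq0 : (0 : ℝ) < q := by exact_mod_cast hqp.pos
  have hq3' : (3 : ℝ) ≤ q := by exact_mod_cast hq3
  set L := Real.log q with hL
  set ℓ := Real.log L with hℓ
  set Y := ⌊L⌋₊ + 1 with hYdef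
  have hL101 : 101 ≤ L := by linarith [Real.add_one_le_exp 100]
  have hL0 : 0 < L := by linarith
  have hℓ0 : 0 < ℓ := by linarith
  have hYL : L < Y := by rw [hYdef]; push_cast; exact Nat.lt_floor_add_one L
  have hYL2 : (Y : ℝ) ≤ 2 * L := by
    rw [hYdef]; push_cast; linarith [Nat.floor_le hL0.le]
  have hqexp : (q : ℝ) = Real.exp L := (Real.exp_log hq0).symm
  set x := L ^ A with hx
  have hx0 : 0 < x := by positivity
  have hx1 : 1 ≤ x := Real.one_le_rpow (by linarith) hA.le
  have hxexp : x = Real.exp (A * ℓ) := by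
    rw [hx, Real.rpow_def_of_pos hL0, mul_comm]
  have hxq : x < q := by
    rw [hxexp, hqexp, Real.exp_lt_exp]
    nlinarith
  have hYpos : (0 : ℝ) < Y := hL0.trans hYL
  have hT : c₀ * x ≤ #(Nat.smoothNumbersUpTo ⌊x⌋₊ Y) := by
    refine le_trans (mul_le_mul_of_nonneg_right (min_le_left _ _) hx0.le)
      (hlow Y (hL100.trans hYL.le) x hx1 ?_)
    rw [pow_mul, Real.sq_sqrt hYpos.le, ← Real.rpow_natCast]
    calc x ≤ (Y : ℝ) ^ A := Real.rpow_le_rpow hL0.le hYL.le hA.le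
      _ ≤ _ := Real.rpow_le_rpow_of_exponent_le (by linarith) (Nat.le_ceil A)
  have hTsub : Nat.smoothNumbersUpTo ⌊x⌋₊ Y ⊆ Icc 1 ⌊x⌋₊ := fun n hn => by
    rw [Nat.mem_smoothNumbersUpTo] at hn
    exact mem_Icc.2 ⟨Nat.pos_of_ne_zero (Nat.ne_zero_of_mem_smoothNumbers hn.2), hn.1⟩
  set D := L / ℓ with hD
  have hD4 : 4 * A + 1 ≤ D := (le_div_iff₀ hℓ0).2 hLA
  have hDℓ : D * ℓ = L := by rw [hD]; field_simp
  -- Here `x^k = exp(k A log L) ≤ exp(L / 2)`, so all products stay below `q`; since `D ≥ 4A`, the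
  -- floor loses at most half.
  set k := ⌊D / (2 * A)⌋₊ with hk
  have hk1 : (k : ℝ) ≤ D / (2 * A) := Nat.floor_le (by positivity)
  have hk2 : D / (4 * A) ≤ k := by
    have h1 := Nat.lt_floor_add_one (D / (2 * A))
    have h2 : 1 ≤ D / (4 * A) := (one_le_div (by positivity)).2 (by linarith)
    have h3 : D / (2 * A) = D / (4 * A) + D / (4 * A) := by field_simp; ring
    linarith
  have hkA : k * (2 * A) ≤ D := (le_div_iff₀ (by positivity)).1 hk1
  have hkA' : D ≤ k * (4 * A) := (div_le_iff₀ (by positivity)).1 hk2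
  have hxk : x ^ k ≤ q := by
    rw [hxexp, hqexp, ← Real.exp_nat_mul, Real.exp_le_exp]
    nlinarith
  have hΨ : (#(Nat.smoothNumbersUpTo ⌊(q : ℝ)⌋₊ Y) : ℝ) ≤ Real.exp (2 * C * D) := by
    refine (hup q hq0 (by rw [hqexp, Real.exp_le_exp]; exact hYL.le)).trans ?_
    rw [Real.exp_le_exp]
    have : (Y : ℝ) / Real.log Y ≤ 2 * L / ℓ := by
      refine div_le_div₀ (by positivity) hYL2 hℓ0 (Real.log_le_log hL0 hYL.le)
    calc C * ((Y : ℝ) / Real.log Y) ≤ C * (2 * L / ℓ) := by gcongr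
      _ = _ := by rw [hD]; ring
  have hsmall : Real.exp (2 * C * D) * Real.exp (-(2 * k * δ)) ≤ 1 / 2 := by
    rw [← Real.exp_add]
    have h1 : 2 * C * D + -(2 * k * δ) ≤ -1 := by
      have h2 : 2 * k * δ = k * (4 * A) * (2 * C + 1) := by rw [hδ]; ring
      have h3 : D * (2 * C + 1) ≤ k * (4 * A) * (2 * C + 1) := by gcongr
      linarith
    calc _ ≤ Real.exp (-1) := Real.exp_le_exp.2 h1
      _ ≤ 1 / 2 := by linarith [Real.exp_neg_one_lt_d9]
  have hB : ∀ t ∈ Fintype.piFinset (fun _ : Fin k => Nat.smoothNumbersUpTo ⌊x⌋₊ Y),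
      ∏ i, t i ∈ Nat.smoothNumbersUpTo ⌊(q : ℝ)⌋₊ Y :=
    fun t ht => prod_mem_smoothNumbersUpTo hx0.le hxk ht
  have key := sub_one_le_of_charSum_small hx0 hxq hTsub hB hΨ hc₀b hT
    (fun χ hχ => (hcon χ hχ).le) hsmall
  rw [← Real.exp_add] at key
  have h1 : 2 * C * D + 2 * k * b ≤ L / 2 := by
    have : 2 * k * b ≤ D * (b / A) := by
      calc 2 * k * b = k * (2 * A) * (b / A) := by field_simp
        _ ≤ _ := by gcongr
    nlinarith
  have h2 : (q : ℝ) ≤ 4 * Real.exp (L / 2) := by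
    have := Real.exp_le_exp.2 h1
    linarith
  have h3 : Real.exp L = Real.exp (L / 2) * Real.exp (L / 2) := by
    rw [← Real.exp_add]; congr 1; ring
  have h4 : L / 2 + 1 ≤ Real.exp (L / 2) := Real.add_one_le_exp _
  rw [hqexp, h3] at h2
  have := le_of_mul_le_mul_right h2 (Real.exp_pos _)
  linarith

end

/-! ### Mellin representation and growth of `L(s, χ)` for `Re s > 0` -/

section

open Finset Filter Topology MeasureTheory

lemma sum_range_natCast_zmod {q : ℕ} [NeZero q] {M : Type*} [AddCommMonoid M] (f : ZMod q → M) :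
    ∑ n ∈ range q, f n = ∑ a : ZMod q, f a :=
  sum_nbij' (fun n => (n : ZMod q)) ZMod.val (fun _ _ => mem_univ _)
    (fun a _ => mem_range.2 a.val_lt) (fun _ hn => ZMod.val_cast_of_lt (mem_range.1 hn))
    (fun a _ => ZMod.natCast_rightInverse a) fun _ _ => rfl

/-- Full periods sum to zero, leaving fewer than `q` terms. -/
lemma norm_sum_range_char_le {q : ℕ} [NeZero q] {χ : DirichletCharacter ℂ q} (hχ : χ ≠ 1) (N : ℕ) :
    ‖∑ n ∈ range N, χ (n : ZMod q)‖ ≤ q := by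
  induction N using Nat.strong_induction_on with
  | _ N ih =>
    rcases lt_or_ge N q with hN | hN
    · calc ‖∑ n ∈ range N, χ (n : ZMod q)‖ ≤ ∑ n ∈ range N, ‖χ (n : ZMod q)‖ := norm_sum_le _ _
        _ ≤ ∑ n ∈ range N, (1 : ℝ) := sum_le_sum fun n _ => χ.norm_le_one _
        _ = N := by simp
        _ ≤ q := by exact_mod_cast hN.le
    · obtain ⟨m, rfl⟩ := Nat.exists_eq_add_of_le hN
      rw [sum_range_add, sum_range_natCast_zmod fun a => χ a, MulChar.sum_eq_zero_of_ne_one hχ,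
        zero_add]
      simpa using ih m (by have := NeZero.pos q; omega)

lemma norm_sum_Icc_char_le {q : ℕ} [NeZero q] {χ : DirichletCharacter ℂ q} (hχ : χ ≠ 1) (N : ℕ) :
    ‖∑ n ∈ Icc 1 N, χ (n : ZMod q)‖ ≤ 2 * q := by
  have h : ∑ n ∈ Icc 1 N, χ (n : ZMod q) =
      ∑ n ∈ range (N + 1), χ (n : ZMod q) - ∑ n ∈ range 1, χ (n : ZMod q) := by
    rw [← sum_Ico_eq_sub _ (by omega)]
    rfl
  rw [h]
  have h1 := norm_sum_range_char_le hχ (N + 1)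
  have h2 := norm_sum_range_char_le hχ 1
  linarith [norm_sub_le (∑ n ∈ range (N + 1), χ (n : ZMod q)) (∑ n ∈ range 1, χ (n : ZMod q))]

lemma charSum_eq_zero_of_lt_one {q : ℕ} (χ : DirichletCharacter ℂ q) {t : ℝ} (ht : t < 1) :
    charSum χ t = 0 := by
  rw [charSum, Nat.floor_eq_zero.2 ht]
  rfl

lemma norm_charSum_le_modulus {q : ℕ} [NeZero q] {χ : DirichletCharacter ℂ q} (hχ : χ ≠ 1)
    (t : ℝ) : ‖charSum χ t‖ ≤ 2 * q := norm_sum_Icc_char_le hχ _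

lemma locallyIntegrable_charSum {q : ℕ} (χ : DirichletCharacter ℂ q) :
    LocallyIntegrableOn (charSum χ) (Set.Ioi 0) := by
  have h := locallyIntegrableOn_mul_sum_Icc (fun n : ℕ => χ (n : ZMod q)) (m := 1) (le_refl (0 : ℝ))
    (g := fun _ => (1 : ℂ)) (locallyIntegrableOn_const 1)
  simp only [one_mul] at h
  exact h.mono_set Set.Ioi_subset_Ici_self

lemma differentiableAt_mellin_charSum {q : ℕ} [NeZero q] {χ : DirichletCharacter ℂ q} (hχ : χ ≠ 1)
    {s : ℂ} (hs : s.re < 0) : DifferentiableAt ℂ (mellin (charSum χ)) s := by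
  refine mellin_differentiableAt_of_isBigO_rpow (a := 0) (b := s.re - 1)
    (locallyIntegrable_charSum χ) ?_ hs ?_ (by linarith)
  · refine Asymptotics.IsBigO.of_bound (2 * q) (Eventually.of_forall fun t => ?_)
    simpa using norm_charSum_le_modulus hχ t
  · refine Asymptotics.IsBigO.of_bound 1 ?_
    filter_upwards [nhdsWithin_le_nhds (gt_mem_nhds (zero_lt_one' ℝ))] with t ht
    rw [charSum_eq_zero_of_lt_one χ ht, norm_zero]
    positivity

lemma mellin_charSum_eq {q : ℕ} (χ : DirichletCharacter ℂ q) (s : ℂ) :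
    mellin (charSum χ) (-s) = ∫ t in Set.Ioi (1 : ℝ), charSum χ t * (t : ℂ) ^ (-(s + 1)) := by
  rw [mellin, setIntegral_eq_of_subset_of_forall_sdiff_eq_zero (s := Set.Ici 1)
    measurableSet_Ioi (fun t ht => zero_lt_one.trans_le ht) (fun t ht => by
      rw [charSum_eq_zero_of_lt_one χ (by simpa using ht.2), smul_zero]), integral_Ici_eq_integral_Ioi]
  refine setIntegral_congr_fun measurableSet_Ioi fun t _ => ?_
  simp only [smul_eq_mul]
  rw [mul_comm, neg_add']

/-- For `Re s > 1` this is partial summation. As `charSum χ` is bounded and vanishes on `t < 1`, the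
right side is analytic for `Re s > 0`, and the identity theorem extends the equality. -/
lemma LFunction_eq_mul_mellin {q : ℕ} [NeZero q] {χ : DirichletCharacter ℂ q} (hχ : χ ≠ 1)
    {s : ℂ} (hs : 0 < s.re) :
    DirichletCharacter.LFunction χ s = s * mellin (charSum χ) (-s) := by
  have hopen : IsOpen {z : ℂ | 0 < z.re} := isOpen_lt continuous_const Complex.continuous_re
  have h1 : AnalyticOnNhd ℂ (DirichletCharacter.LFunction χ) {z : ℂ | 0 < z.re} :=
    (DirichletCharacter.differentiable_LFunction hχ).differentiableOn.analyticOnNhd hopen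
  have h2 : AnalyticOnNhd ℂ (fun z => z * mellin (charSum χ) (-z)) {z : ℂ | 0 < z.re} := by
    refine DifferentiableOn.analyticOnNhd (fun z hz => DifferentiableAt.differentiableWithinAt ?_)
      hopen
    refine differentiableAt_id.mul ?_
    exact (differentiableAt_mellin_charSum hχ (by simpa using hz)).comp z differentiableAt_id.neg
  have h3 : IsPreconnected {z : ℂ | 0 < z.re} := (convex_halfSpace_re_gt 0).isPreconnected
  refine h1.eqOn_of_preconnected_of_eventuallyEq h2 h3 (z₀ := 2) (by simp) ?_ hs
  filter_upwards [(isOpen_lt continuous_const Complex.continuous_re).mem_nhds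
    (show (1 : ℝ) < (2 : ℂ).re by simp)] with z hz
  have hz : 1 < z.re := hz
  rw [DirichletCharacter.LFunction_eq_LSeries χ hz, mellin_charSum_eq]
  refine LSeries_eq_mul_integral _ le_rfl (by linarith)
    (DirichletCharacter.LSeriesSummable_of_one_lt_re χ hz) ?_
  refine Asymptotics.IsBigO.of_bound (2 * q) (Eventually.of_forall fun n => ?_)
  simpa using norm_sum_Icc_char_le hχ n

/-- The bound is crude, but only its logarithm enters the estimate of `L'/L`. -/
lemma norm_LFunction_le {q : ℕ} [NeZero q] {χ : DirichletCharacter ℂ q} (hχ : χ ≠ 1) {s : ℂ}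
    (hs : 0 < s.re) : ‖DirichletCharacter.LFunction χ s‖ ≤ 2 * q * ‖s‖ / s.re := by
  rw [LFunction_eq_mul_mellin hχ hs, mellin_charSum_eq, norm_mul]
  have h1 : ‖∫ t in Set.Ioi (1 : ℝ), charSum χ t * (t : ℂ) ^ (-(s + 1))‖ ≤
      ∫ t in Set.Ioi (1 : ℝ), 2 * q * t ^ (-s.re - 1) := by
    refine norm_integral_le_of_norm_le ?_ ?_
    · exact (integrableOn_Ioi_rpow_of_lt (by linarith) one_pos).const_mul _
    · filter_upwards [ae_restrict_mem measurableSet_Ioi] with t ht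
      have ht0 : (0 : ℝ) < t := zero_lt_one.trans ht
      rw [norm_mul, Complex.norm_cpow_eq_rpow_re_of_pos ht0]
      have : (-(s + 1)).re = -s.re - 1 := by simp; ring
      rw [this]
      gcongr
      exact norm_charSum_le_modulus hχ t
  rw [integral_const_mul, integral_Ioi_rpow_of_lt (by linarith) one_pos, Real.one_rpow] at h1
  calc _ ≤ ‖s‖ * (2 * q * (-1 / (-s.re - 1 + 1))) := by gcongr
    _ = _ := by
      rw [show -s.re - 1 + 1 = -s.re by ring, neg_div_neg_eq]; ring

end

/-! ### The logarithmic derivative of `L(s, χ)` under GRH -/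

section

open Finset Filter Topology MeasureTheory

/-- A bound for the logarithmic derivative of a nonvanishing holomorphic function in a disc in
terms of its growth, by the Borel–Carathéodory theorem. -/
lemma norm_logDeriv_le_of_norm_le {F : ℂ → ℂ} {c : ℂ} {R r δ B : ℝ} (hδ : 0 < δ)
    (hR : r + 2 * δ = R) (hF : DifferentiableOn ℂ F (Metric.ball c R))
    (hF0 : ∀ z ∈ Metric.ball c R, F z ≠ 0) (hB : 1 < B)
    (hFB : ∀ z ∈ Metric.ball c R, ‖F z‖ ≤ B * ‖F c‖) {s : ℂ} (hs : ‖s - c‖ ≤ r) :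
    ‖deriv F s / F s‖ ≤ 2 * R * Real.log B / δ ^ 2 := by
  have hr : 0 ≤ r := (norm_nonneg _).trans hs
  have hR0 : 0 < R := by linarith
  have hopen : IsOpen (Metric.ball c R) := Metric.isOpen_ball
  have hlogB : 0 < Real.log B := Real.log_pos hB
  have hc : c ∈ Metric.ball c R := Metric.mem_ball_self hR0
  have hFc := hF0 c hc
  have hL : DifferentiableOn ℂ (fun z => deriv F z / F z) (Metric.ball c R) :=
    (hF.deriv hopen).div hF hF0
  -- A primitive of `F'/F` vanishing at `c` is a holomorphic logarithm of `F / F c`; the growth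
  -- hypothesis bounds its real part by `log B`.
  obtain ⟨f, hfc, hf⟩ := hL.isExactOn_ball.with_val_at c 0
  have hFd : ∀ z ∈ Metric.ball c R, HasDerivAt F (deriv F z) z := fun z hz =>
    (hF.differentiableAt (hopen.mem_nhds hz)).hasDerivAt
  have hexp : ∀ z ∈ Metric.ball c R, F z = F c * Complex.exp (f z) := fun z hz => by
    have hd : ∀ w ∈ Metric.ball c R, HasDerivAt (fun w => F w * Complex.exp (-f w)) 0 w :=
      fun w hw => by
        have := (hFd w hw).mul (hf w hw).neg.cexp
        refine this.congr_deriv ?_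
        have := hF0 w hw
        field_simp
        ring
    have := hopen.is_const_of_deriv_eq_zero (convex_ball c R).isPreconnected
      (fun w hw => (hd w hw).differentiableAt.differentiableWithinAt)
      (fun w hw => (hd w hw).deriv) hz hc
    simp only [hfc, neg_zero, Complex.exp_zero, mul_one] at this
    rw [← this, mul_assoc, ← Complex.exp_add, neg_add_cancel, Complex.exp_zero, mul_one]
  have hre : ∀ z ∈ Metric.ball c R, (f z).re ≤ Real.log B := fun z hz => by
    have h := hFB z hz
    rw [hexp z hz, norm_mul, Complex.norm_exp, mul_comm] at h
    exact (Real.le_log_iff_exp_le (by linarith)).2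
      (le_of_mul_le_mul_right h (norm_pos_iff.2 hFc))
  have hg : ∀ z ∈ Metric.ball (0 : ℂ) R, z + c ∈ Metric.ball c R := fun z hz => by
    simpa using hz
  -- Of the gap `2δ` between `r` and `R`, Borel–Carathéodory uses one `δ`, and Cauchy's estimate for
  -- the derivative of `f` uses the other.
  have hbc : ∀ z ∈ Metric.ball c R, ‖z - c‖ ≤ r + δ → ‖f z‖ ≤ 2 * R * Real.log B / δ :=
    fun z hz hzr => by
      have h := Complex.borelCaratheodory_zero (f := fun w => f (w + c)) (z := z - c) hlogB
        (fun w hw => ((hf _ (hg w hw)).differentiableAt.comp w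
          (differentiableAt_id.add_const c)).differentiableWithinAt)
        (fun w hw => hre _ (hg w hw)) hR0 (by simpa [dist_eq_norm] using hz) (by simpa using hfc)
      simp only [sub_add_cancel] at h
      refine h.trans (div_le_div₀ (by positivity) ?_ hδ (by linarith))
      have : ‖z - c‖ ≤ R := by linarith
      nlinarith
  have hsub : Metric.closedBall s δ ⊆ Metric.ball c R := fun z hz => by
    rw [Metric.mem_closedBall, dist_eq_norm] at hz
    rw [Metric.mem_ball, dist_eq_norm]
    calc ‖z - c‖ ≤ ‖z - s‖ + ‖s - c‖ := norm_sub_le_norm_sub_add_norm_sub _ _ _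
      _ < R := by linarith
  have hsR : s ∈ Metric.ball c R := hsub (Metric.mem_closedBall_self hδ.le)
  rw [← (hf s hsR).deriv]
  have hcl : closure (Metric.ball s δ) = Metric.closedBall s δ := closure_ball s hδ.ne'
  refine (Complex.norm_deriv_le_of_forall_mem_sphere_norm_le (C := 2 * R * Real.log B / δ) hδ
    ⟨fun z hz => (hf z (hsub (Metric.ball_subset_closedBall hz))).differentiableAt.differentiableWithinAt,
      fun z hz => (hf z (hsub (hcl ▸ hz))).continuousAt.continuousWithinAt⟩ fun z hz => ?_).trans ?_
  · refine hbc z (hsub (Metric.sphere_subset_closedBall hz)) ?_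
    rw [mem_sphere_iff_norm] at hz
    calc ‖z - c‖ ≤ ‖z - s‖ + ‖s - c‖ := norm_sub_le_norm_sub_add_norm_sub _ _ _
      _ ≤ r + δ := by linarith
  · rw [div_div, sq]

lemma norm_LSeries_le_two {f : ℕ → ℂ} (hf : ∀ n, ‖f n‖ ≤ 1) {s : ℂ} (hs : s.re = 2) :
    ‖LSeries f s‖ ≤ 2 := by
  have h := hasSum_zeta_two
  have hle : ∀ n : ℕ, ‖LSeries.term f s n‖ ≤ 1 / (n : ℝ) ^ 2 := fun n => by
    rw [LSeries.norm_term_eq, hs]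
    split_ifs with h0
    · simp [h0]
    · rw [Real.rpow_two]
      gcongr
      exact hf n
  refine (tsum_of_norm_bounded h hle).trans ?_
  nlinarith [Real.pi_lt_d2, Real.pi_pos]

/-- The inverse of `L(s, χ)` is the Dirichlet series of `χ μ`, bounded by `ζ(2) ≤ 2` on this line.
-/
lemma half_le_norm_LFunction {q : ℕ} [NeZero q] (χ : DirichletCharacter ℂ q) {s : ℂ}
    (hs : s.re = 2) : 1 / 2 ≤ ‖DirichletCharacter.LFunction χ s‖ := by
  have hs1 : 1 < s.re := by rw [hs]; norm_num
  rw [DirichletCharacter.LFunction_eq_LSeries χ hs1]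
  have h1 := congrArg norm (DirichletCharacter.LSeries.mul_mu_eq_one χ hs1)
  have h2 := norm_LSeries_le_two (f := (fun n : ℕ => χ (n : ZMod q)) *
    fun n => ((ArithmeticFunction.moebius n : ℤ) : ℂ)) (fun n => ?_) hs
  · rw [norm_mul, norm_one] at h1
    have h3 := norm_nonneg (LSeries (fun n : ℕ => χ (n : ZMod q)) s)
    nlinarith
  · rw [Pi.mul_apply, norm_mul]
    refine mul_le_one₀ (χ.norm_le_one _) (norm_nonneg _) ?_
    rw [Complex.norm_intCast]
    exact_mod_cast ArithmeticFunction.abs_moebius_le_one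

lemma LFunction_ne_zero_of_GRH (h : GeneralizedRiemannHypothesis) {q : ℕ} [NeZero q]
    {χ : DirichletCharacter ℂ q} (hχ : χ ≠ 1) {s : ℂ} (hs : 1 / 2 < s.re) :
    DirichletCharacter.LFunction χ s ≠ 0 := fun h0 => by
  rcases lt_or_ge s.re 1 with h1 | h1
  · linarith [h q χ s h0 (by linarith) h1]
  · exact DirichletCharacter.LFunction_ne_zero_of_one_le_re χ (.inl hχ) h1 h0

/-- Under GRH, the logarithmic derivative of `L(s, χ)` grows slowly to the right of `Re s = 3/4`. -/
lemma norm_logDeriv_LFunction_le (h : GeneralizedRiemannHypothesis) {q : ℕ} [NeZero q]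
    (hq : 1 ≤ Real.log q) {χ : DirichletCharacter ℂ q} (hχ : χ ≠ 1) {s : ℂ} (hs : 3 / 4 ≤ s.re)
    (hs2 : s.re ≤ 2) :
    ‖deriv (DirichletCharacter.LFunction χ) s / DirichletCharacter.LFunction χ s‖ ≤
      2000 * Real.log q * (1 + |s.im|) ^ (1 / 2 : ℝ) := by
  have hq0 : (1 : ℝ) ≤ q := by exact_mod_cast NeZero.pos q
  -- Around this centre, radius `3/2` stays in the zero-free half-plane `Re z > 1/2` and radius
  -- `5/4` reaches `Re s = 3/4`.
  set c : ℂ := ⟨2, s.im⟩ with hc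
  have hcs : ‖s - c‖ ≤ 5 / 4 := by
    have : s - c = ((s.re - 2 : ℝ) : ℂ) := by
      apply Complex.ext <;> simp [hc]
    rw [this, Complex.norm_real, Real.norm_eq_abs, abs_le]
    constructor <;> linarith
  have hre : ∀ z ∈ Metric.ball c (3 / 2), 1 / 2 < z.re := fun z hz => by
    have h1 := (Complex.abs_re_le_norm (z - c)).trans_lt (mem_ball_iff_norm.1 hz)
    have := (abs_lt.1 h1).1
    simp [hc] at this
    linarith
  have hbound : ∀ z ∈ Metric.ball c (3 / 2), ‖DirichletCharacter.LFunction χ z‖ ≤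
      32 * q * (1 + |s.im|) * ‖DirichletCharacter.LFunction χ c‖ := fun z hz => by
    have hz' := hre z hz
    have h1 := norm_LFunction_le hχ (show 0 < z.re by linarith)
    have h2 : ‖z‖ ≤ 4 * (1 + |s.im|) := by
      have h3 : ‖c‖ ≤ 2 + |s.im| := by
        simpa [hc] using Complex.norm_le_abs_re_add_abs_im c
      have h4 := (mem_ball_iff_norm.1 hz).le
      have h5 : ‖z‖ ≤ ‖z - c‖ + ‖c‖ := by simpa using norm_add_le (z - c) c
      have := abs_nonneg s.im
      linarith
    have h6 := half_le_norm_LFunction χ (show c.re = 2 from rfl)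
    calc _ ≤ 2 * q * ‖z‖ / z.re := h1
      _ ≤ 2 * q * (4 * (1 + |s.im|)) / (1 / 2) := by gcongr
      _ = 32 * q * (1 + |s.im|) * (1 / 2) := by ring
      _ ≤ _ := by gcongr
  have hw : 1 ≤ 1 + |s.im| := by linarith [abs_nonneg s.im]
  have key := norm_logDeriv_le_of_norm_le (F := DirichletCharacter.LFunction χ) (c := c) (R := 3 / 2)
    (r := 5 / 4) (δ := 1 / 8) (B := 32 * q * (1 + |s.im|)) (by norm_num) (by norm_num)
    (DirichletCharacter.differentiable_LFunction hχ).differentiableOn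
    (fun z hz => LFunction_ne_zero_of_GRH h hχ (hre z hz)) (by nlinarith) hbound hcs
  refine key.trans ?_
  -- Replacing `log(1 + |t|)` by a multiple of `(1 + |t|)^(1/2)` is harmless: against the kernel
  -- `s^(-2)` the integrand still decays like `|t|^(-3/2)`.
  have hlog : Real.log (32 * q * (1 + |s.im|)) ≤
      8 * Real.log q * (1 + |s.im|) ^ (1 / 2 : ℝ) := by
    rw [Real.log_mul (by positivity) (by positivity), Real.log_mul (by norm_num) (by positivity)]
    have h1 : Real.log 32 ≤ 5 := by
      rw [show (32 : ℝ) = 2 ^ 5 by norm_num, Real.log_pow]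
      have := Real.log_two_lt_d9
      push_cast; linarith
    have h2 := Real.log_le_rpow_div (show 0 ≤ 1 + |s.im| by linarith) (show (0 : ℝ) < 1 / 2 by norm_num)
    have h3 : 1 ≤ (1 + |s.im|) ^ (1 / 2 : ℝ) := Real.one_le_rpow hw (by norm_num)
    set r := (1 + |s.im|) ^ (1 / 2 : ℝ)
    have h4 : Real.log (1 + |s.im|) ≤ 2 * r := by linarith
    nlinarith [mul_le_mul hq h3 zero_le_one (by linarith)]
  calc _ = 192 * Real.log (32 * q * (1 + |s.im|)) := by ring
    _ ≤ 192 * (8 * Real.log q * (1 + |s.im|) ^ (1 / 2 : ℝ)) := by gcongr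
    _ ≤ _ := by
      have : 0 ≤ Real.log q * (1 + |s.im|) ^ (1 / 2 : ℝ) := by positivity
      linarith

end

/-! ### Contour shift and Perron's formula with kernel `s^(-2)` -/

section

open Filter Topology MeasureTheory

/-- Shifting a vertical line of integration across a strip of holomorphy. -/
lemma integral_vertical_eq_of_strip {H : ℂ → ℂ} {a b B : ℝ} (hab : a ≤ b)
    (hd : ∀ s : ℂ, a ≤ s.re → s.re ≤ b → DifferentiableAt ℂ H s)
    (hB : ∀ s : ℂ, a ≤ s.re → s.re ≤ b → ‖H s‖ ≤ B * (1 + |s.im|) ^ (-(3 / 2) : ℝ)) :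
    ∫ y : ℝ, H (b + y * Complex.I) = ∫ y : ℝ, H (a + y * Complex.I) := by
  have hint0 : Integrable fun y : ℝ => B * (1 + |y|) ^ (-(3 / 2) : ℝ) := by
    have := integrable_one_add_norm (E := ℝ) (μ := volume) (r := 3 / 2) (by simp; norm_num)
    simpa using this.const_mul B
  have hint : ∀ σ : ℝ, a ≤ σ → σ ≤ b → Integrable fun y : ℝ => H (σ + y * Complex.I) :=
    fun σ h1 h2 => by
      refine hint0.mono' (Continuous.aestronglyMeasurable ?_) (Eventually.of_forall fun y => ?_)
      · refine continuous_iff_continuousAt.2 fun y => ?_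
        exact ContinuousAt.comp (f := fun y : ℝ => (σ : ℂ) + y * Complex.I)
          (hd _ (by simpa using h1) (by simpa using h2)).continuousAt (by fun_prop)
      · simpa using hB (σ + y * Complex.I) (by simpa using h1) (by simpa using h2)
  have hlim : ∀ σ : ℝ, a ≤ σ → σ ≤ b → Tendsto (fun T : ℝ => ∫ y in (-T)..T,
      H (σ + y * Complex.I)) atTop (𝓝 (∫ y : ℝ, H (σ + y * Complex.I))) := fun σ h1 h2 =>
    intervalIntegral_tendsto_integral (hint σ h1 h2) tendsto_neg_atTop_atBot tendsto_id
  have hhor : ∀ ε : ℝ, (ε = 1 ∨ ε = -1) → Tendsto (fun T : ℝ => ∫ x in a..b,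
      H (x + ((ε * T : ℝ) : ℂ) * Complex.I)) atTop (𝓝 0) := fun ε hε => by
    have habs : |ε| = 1 := by rcases hε with rfl | rfl <;> simp
    have h0 : Tendsto (fun T : ℝ => B * (1 + T) ^ (-(3 / 2) : ℝ) * |b - a|) atTop (𝓝 0) := by
      have := ((tendsto_rpow_neg_atTop (show (0 : ℝ) < 3 / 2 by norm_num)).comp
        (tendsto_atTop_add_const_left atTop 1 tendsto_id)).const_mul B |>.mul_const |b - a|
      simpa using this
    refine squeeze_zero_norm' ?_ h0
    filter_upwards [eventually_ge_atTop 0] with T hT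
    refine intervalIntegral.norm_integral_le_of_norm_le_const fun x hx => ?_
    rw [Set.uIoc_of_le hab] at hx
    have := hB (x + ((ε * T : ℝ) : ℂ) * Complex.I) (by simpa using hx.1.le) (by simpa using hx.2)
    simpa [abs_mul, habs, abs_of_nonneg hT] using this
  have hrect : ∀ T : ℝ, (∫ x in a..b, H (x + ((-1 * T : ℝ) : ℂ) * Complex.I)) -
      (∫ x in a..b, H (x + ((1 * T : ℝ) : ℂ) * Complex.I)) +
      Complex.I • (∫ y in (-T)..T, H (b + y * Complex.I)) -
      Complex.I • (∫ y in (-T)..T, H (a + y * Complex.I)) = 0 := fun T => by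
    have := Complex.integral_boundary_rect_eq_zero_of_differentiableOn H ⟨a, -T⟩ ⟨b, T⟩
      (fun s hs => by
        have h1 := hs.1
        simp only [Set.mem_preimage, Set.uIcc_of_le hab, Set.mem_Icc] at h1
        exact (hd s h1.1 h1.2).differentiableWithinAt)
    simpa using this
  have hl := (((hhor (-1) (.inr rfl)).sub (hhor 1 (.inl rfl))).add
    ((hlim b hab le_rfl).const_smul Complex.I)).sub ((hlim a le_rfl hab).const_smul Complex.I)
  have h := tendsto_nhds_unique (hl.congr fun T => hrect T) tendsto_const_nhds
  rw [sub_zero, zero_add, ← smul_sub, smul_eq_zero, sub_eq_zero] at h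
  exact h.resolve_left Complex.I_ne_zero

/-- The function whose Mellin transform is `1 / s ^ 2`. -/
lemma hasMellin_log_Ioc {s : ℂ} (hs : 0 < s.re) :
    MellinConvergent (fun t : ℝ => ((Real.posLog t⁻¹ : ℝ) : ℂ)) s ∧
      mellin (fun t : ℝ => ((Real.posLog t⁻¹ : ℝ) : ℂ)) s = 1 / s ^ 2 := by
  set f : ℝ → ℂ := Set.indicator (Set.Ioc 0 1) fun _ => 1 with hf
  have hfi : LocallyIntegrableOn f (Set.Ioi 0) := by
    refine (locallyIntegrable_const (1 : ℂ)).indicator measurableSet_Ioc |>.locallyIntegrableOn _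
  -- The indicator of `(0, 1]` has Mellin transform `1 / s`, and differentiating in `s` inserts a
  -- factor `log t`.
  have h := mellin_hasDerivAt_of_isBigO_rpow (f := f) (a := s.re + 1) (b := 0) hfi
    (by
      refine Asymptotics.IsBigO.of_bound 1 ?_
      filter_upwards [eventually_gt_atTop 1] with t ht
      rw [hf, Set.indicator_of_notMem (fun h => by linarith [h.2]), norm_zero]
      positivity) (by linarith)
    (by
      refine Asymptotics.IsBigO.of_bound 1 (Eventually.of_forall fun t => ?_)
      rw [hf]
      by_cases ht : t ∈ Set.Ioc (0 : ℝ) 1 <;> simp [ht]) hs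
  have hEq : ∀ t ∈ Set.Ioi (0 : ℝ), ((Real.posLog t⁻¹ : ℝ) : ℂ) = -(Real.log t • f t) :=
    fun t ht => by
      have ht : (0 : ℝ) < t := ht
      rcases le_or_gt t 1 with h1 | h1
      · rw [hf, Set.indicator_of_mem (Set.mem_Ioc.2 ⟨ht, h1⟩), Real.posLog_eq_log, Real.log_inv]
        · simp
        · rw [abs_of_pos (by positivity)]
          exact (one_le_inv₀ ht).2 h1
      · rw [hf, Set.indicator_of_notMem (fun h => by linarith [h.2]), smul_zero, neg_zero,
          Real.posLog_eq_zero_iff _ |>.2, Complex.ofReal_zero]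
        rw [abs_of_pos (by positivity)]
        exact inv_le_one_of_one_le₀ h1.le
  have hconv : MellinConvergent (fun t : ℝ => ((Real.posLog t⁻¹ : ℝ) : ℂ)) s := by
    refine (integrableOn_congr_fun (fun t ht => ?_) measurableSet_Ioi).2 (h.1.neg)
    simp only [hEq t ht, smul_neg, Pi.neg_apply]
  refine ⟨hconv, ?_⟩
  have h1 : mellin (fun t : ℝ => ((Real.posLog t⁻¹ : ℝ) : ℂ)) s =
      -mellin (fun t => Real.log t • f t) s := by
    rw [mellin, mellin, ← integral_neg]
    refine setIntegral_congr_fun measurableSet_Ioi fun t ht => ?_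
    simp only [hEq t ht, smul_neg]
  have hs0 : s ≠ 0 := fun h0 => by simp [h0] at hs
  have h2 : HasDerivAt (mellin f) (-1 / s ^ 2) s := by
    have h3 : HasDerivAt (fun z : ℂ => 1 / z) (-1 / s ^ 2) s := by
      simpa [neg_div] using hasDerivAt_inv hs0
    refine h3.congr_of_eventuallyEq ?_
    filter_upwards [(isOpen_lt continuous_const Complex.continuous_re).mem_nhds hs] with z hz
    exact (hasMellin_one_Ioc hz).2
  rw [h1, h.2.unique h2]
  ring

lemma integrable_vertical_inv_sq {σ : ℝ} (hσ : 0 < σ) :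
    Integrable fun y : ℝ => 1 / ((σ : ℂ) + y * Complex.I) ^ 2 := by
  have h0 : Integrable fun y : ℝ => (min 1 σ) ^ (-2 : ℝ) * 4 * (1 + |y|) ^ (-2 : ℝ) := by
    have := integrable_one_add_norm (E := ℝ) (μ := volume) (r := 2) (by simp)
    simpa using this.const_mul _
  have hne : ∀ y : ℝ, (σ : ℂ) + y * Complex.I ≠ 0 := fun y h => by
    have := congrArg Complex.re h
    simp at this
    linarith
  refine h0.mono' (Continuous.aestronglyMeasurable ?_) (Eventually.of_forall fun y => ?_)
  · exact continuous_const.div (by fun_prop) fun y => pow_ne_zero _ (hne y)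
  · have h1 := Complex.abs_re_le_norm ((σ : ℂ) + y * Complex.I)
    have h2 := Complex.abs_im_le_norm ((σ : ℂ) + y * Complex.I)
    simp only [Complex.add_re, Complex.ofReal_re, Complex.mul_re, Complex.I_re, mul_zero,
      Complex.ofReal_im, Complex.I_im, mul_one, sub_self, add_zero, Complex.add_im, Complex.mul_im,
      zero_add, abs_of_pos hσ] at h1 h2
    set m := min 1 σ
    have hm : 0 < m := lt_min one_pos hσ
    have hm1 : m ≤ 1 := min_le_left _ _
    have h3 : m * (1 + |y|) ≤ 2 * ‖(σ : ℂ) + y * Complex.I‖ := by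
      have : m ≤ σ := min_le_right _ _
      nlinarith [abs_nonneg y]
    have hw : 0 < 1 + |y| := by linarith [abs_nonneg y]
    rw [norm_div, norm_one, norm_pow, Real.rpow_neg hm.le, Real.rpow_neg hw.le, Real.rpow_two,
      Real.rpow_two, show (m ^ 2)⁻¹ * 4 * ((1 + |y|) ^ 2)⁻¹ = 1 / ((m * (1 + |y|) / 2) ^ 2) by
        field_simp; ring]
    gcongr
    linarith

/-- The Perron formula with the kernel `s⁻²`. -/
lemma integral_cpow_div_sq {u σ : ℝ} (hu : 0 < u) (hσ : 0 < σ) :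
    ∫ y : ℝ, (u : ℂ) ^ ((σ : ℂ) + y * Complex.I) / ((σ : ℂ) + y * Complex.I) ^ 2 =
      2 * Real.pi * (Real.posLog u : ℝ) := by
  have h0 := fun y : ℝ => hasMellin_log_Ioc (s := (σ : ℂ) + y * Complex.I) (by simpa using hσ)
  have hσ' := hasMellin_log_Ioc (s := (σ : ℂ)) (by simpa using hσ)
  -- Mellin inversion at `1 / u`. The function `log⁺` is continuous even at its corner, so no case
  -- `u = 1` has to be excluded.
  have h := mellinInv_mellin_eq σ (fun t : ℝ => ((Real.posLog t⁻¹ : ℝ) : ℂ)) (inv_pos.2 hu) hσ'.1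
    (by
      refine (integrable_vertical_inv_sq hσ).congr (Eventually.of_forall fun y => ?_)
      exact (h0 y).2.symm)
    (by
      refine Complex.continuous_ofReal.continuousAt.comp ?_
      exact Real.continuous_posLog.continuousAt.comp (continuousAt_inv₀ (inv_pos.2 hu).ne'))
  rw [mellinInv, inv_inv] at h
  have h2 : ∀ y : ℝ, (((u⁻¹ : ℝ) : ℂ) ^ (-((σ : ℂ) + y * Complex.I)) •
      mellin (fun t : ℝ => ((Real.posLog t⁻¹ : ℝ) : ℂ)) ((σ : ℂ) + y * Complex.I)) =
      (u : ℂ) ^ ((σ : ℂ) + y * Complex.I) / ((σ : ℂ) + y * Complex.I) ^ 2 := fun y => by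
    rw [(h0 y).2, smul_eq_mul, mul_one_div, Complex.ofReal_inv,
      Complex.inv_cpow _ _ (by rw [Complex.arg_ofReal_of_nonneg hu.le]; exact Real.pi_pos.ne),
      Complex.cpow_neg, inv_inv]
  simp only [h2] at h
  generalize (∫ y : ℝ, (u : ℂ) ^ ((σ : ℂ) + y * Complex.I) / ((σ : ℂ) + y * Complex.I) ^ 2) = J
    at h ⊢
  rw [← h, Complex.real_smul]
  push_cast
  field_simp

end

/-! ### Logarithmically weighted sums of `Λ χ` under GRH -/

section

open Filter Topology MeasureTheory ArithmeticFunction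

/-- The integrand of the contour integral for logarithmically weighted sums of `Λ χ`. -/
noncomputable def perronIntegrand {q : ℕ} [NeZero q] (χ : DirichletCharacter ℂ q) (z : ℝ)
    (s : ℂ) : ℂ :=
  -(deriv (DirichletCharacter.LFunction χ) s / DirichletCharacter.LFunction χ s) * (z : ℂ) ^ s / s ^ 2

lemma norm_perronIntegrand_le (h : GeneralizedRiemannHypothesis) {q : ℕ} [NeZero q]
    (hq : 1 ≤ Real.log q) {χ : DirichletCharacter ℂ q} (hχ : χ ≠ 1) {z : ℝ} (hz : 0 < z) {s : ℂ}
    (hs : 3 / 4 ≤ s.re) (hs2 : s.re ≤ 2) :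
    ‖perronIntegrand χ z s‖ ≤
      16000 * Real.log q * z ^ s.re * (1 + |s.im|) ^ (-(3 / 2) : ℝ) := by
  have h1 := norm_logDeriv_LFunction_le h hq hχ hs hs2
  have hw : 1 ≤ 1 + |s.im| := by linarith [abs_nonneg s.im]
  -- This averages `‖s‖ ≥ 3/4` and `‖s‖ ≥ |s.im|`.
  have h2 : (1 + |s.im|) * (3 / 8) ≤ ‖s‖ := by
    have h3 := (le_abs_self s.re).trans (Complex.abs_re_le_norm s)
    have h4 := Complex.abs_im_le_norm s
    linarith
  have h5 : (1 + |s.im|) ^ (-(3 / 2) : ℝ) = (1 + |s.im|) ^ (1 / 2 : ℝ) / (1 + |s.im|) ^ 2 := by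
    rw [← Real.rpow_natCast, ← Real.rpow_sub (by linarith)]
    norm_num
  rw [perronIntegrand, norm_div, norm_mul, norm_neg, norm_pow,
    Complex.norm_cpow_eq_rpow_re_of_pos hz, h5]
  calc _ ≤ 2000 * Real.log q * (1 + |s.im|) ^ (1 / 2 : ℝ) * z ^ s.re /
        ((1 + |s.im|) * (3 / 8)) ^ 2 := by gcongr
    _ = (64 / 9 * 2000) * (Real.log q * z ^ s.re * ((1 + |s.im|) ^ (1 / 2 : ℝ) /
        (1 + |s.im|) ^ 2)) := by field_simp; ring
    _ ≤ 16000 * (Real.log q * z ^ s.re * ((1 + |s.im|) ^ (1 / 2 : ℝ) /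
        (1 + |s.im|) ^ 2)) := by gcongr; norm_num
    _ = _ := by ring

/-- On `Re s = 2` the function `-L'/L` is the absolutely convergent Dirichlet series of `χ Λ`, so
Perron's formula applies term by term; `log⁺(z / d)` cuts the sum off at `d ≤ z`. -/
lemma integral_perronIntegrand_two {q : ℕ} [NeZero q] (χ : DirichletCharacter ℂ q) {z : ℝ}
    (hz : 0 < z) :
    ∫ y : ℝ, perronIntegrand χ z ((2 : ℝ) + y * Complex.I) =
      2 * Real.pi * ∑ d ∈ Finset.Ioc 0 ⌊z⌋₊, χ (d : ZMod q) * (Λ d : ℂ) * (Real.log (z / d) : ℝ) := by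
  set a : ℕ → ℂ := (fun n : ℕ => χ (n : ZMod q)) * fun n => (Λ n : ℂ) with ha
  set w : ℝ → ℂ := fun y => ((2 : ℝ) : ℂ) + y * Complex.I with hw
  have hwre : ∀ y, (w y).re = 2 := fun y => by simp [hw]
  have hw0 : ∀ y, w y ≠ 0 := fun y h0 => by simpa [h0] using hwre y
  have hw1 : ∀ y, 1 < (w y).re := fun y => by rw [hwre]; norm_num
  set F : ℕ → ℝ → ℂ := fun n y => LSeries.term a (w y) n * ((z : ℂ) ^ w y / w y ^ 2) with hF
  have hwc : Continuous w := by fun_prop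
  have hinv := integrable_vertical_inv_sq (σ := 2) (by norm_num)
  have hzc : ∀ u : ℝ, 0 < u → Continuous fun y => (u : ℂ) ^ w y := fun u hu =>
    hwc.const_cpow (Or.inl (Complex.ofReal_ne_zero.2 hu.ne'))
  have hFnorm : ∀ n y, ‖F n y‖ = ‖LSeries.term a 2 n‖ * z ^ (2 : ℝ) * ‖1 / w y ^ 2‖ :=
    fun n y => by
      have : ‖LSeries.term a (w y) n‖ = ‖LSeries.term a 2 n‖ := by
        rw [LSeries.norm_term_eq, LSeries.norm_term_eq, hwre]
        simp
      rw [hF, norm_mul, this, norm_div, norm_div, norm_one,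
        Complex.norm_cpow_eq_rpow_re_of_pos hz, hwre]
      ring
  have hFint : ∀ n, Integrable (F n) := fun n => by
    refine ((hinv.norm.const_mul (‖LSeries.term a 2 n‖ * z ^ (2 : ℝ)))).mono'
      (Continuous.aestronglyMeasurable ?_) (Eventually.of_forall fun y => (hFnorm n y).le)
    refine Continuous.mul ?_ ((hzc z hz).div (hwc.pow 2) fun y => pow_ne_zero _ (hw0 y))
    rcases Nat.eq_zero_or_pos n with rfl | hn
    · simpa using continuous_const
    · simp only [LSeries.term_of_ne_zero hn.ne']
      have hn' : (0 : ℝ) < n := by exact_mod_cast hn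
      refine continuous_const.div (by simpa using hzc n hn') fun y => ?_
      rw [Ne, Complex.cpow_eq_zero_iff]
      exact fun h => hn.ne' (by exact_mod_cast h.1)
  have hsum : Summable fun n => ∫ y, ‖F n y‖ := by
    simp only [hFnorm, integral_const_mul]
    refine Summable.mul_right _ (Summable.mul_right _ ?_)
    exact (DirichletCharacter.LSeriesSummable_twist_vonMangoldt χ
      (show 1 < (2 : ℂ).re by norm_num)).norm
  have key := hasSum_integral_of_summable_integral_norm hFint hsum
  have h1 : ∀ y, ∑' n, F n y = perronIntegrand χ z (w y) := fun y => by
    rw [hF, tsum_mul_right, perronIntegrand, mul_div_assoc]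
    congr 1
    change LSeries a (w y) = _
    rw [ha, DirichletCharacter.LSeries_twist_vonMangoldt_eq χ (hw1 y),
      ← DirichletCharacter.LFunction_eq_LSeries χ (hw1 y),
      ← DirichletCharacter.deriv_LFunction_eq_deriv_LSeries χ (hw1 y), neg_div]
  have h2 : ∀ n, ∫ y, F n y = a n * (2 * Real.pi * (Real.posLog (z / n) : ℝ)) := fun n => by
    rcases Nat.eq_zero_or_pos n with rfl | hn
    · simp [hF, ha]
    · have hn' : (0 : ℝ) < n := by exact_mod_cast hn
      rw [← integral_cpow_div_sq (div_pos hz hn') (show (0 : ℝ) < 2 by norm_num),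
        ← integral_const_mul]
      refine integral_congr_ae (Eventually.of_forall fun y => ?_)
      simp only [hF, LSeries.term_of_ne_zero hn.ne']
      rw [Complex.ofReal_div, Complex.div_cpow_ofReal_nonneg hz.le hn'.le]
      simp only [hw, Complex.ofReal_natCast]
      ring
  simp only [h1, h2] at key
  have h3 := key.unique (hasSum_sum_of_ne_finset_zero (s := Finset.Ioc 0 ⌊z⌋₊) fun n hn => ?_)
  · rw [h3, Finset.mul_sum]
    refine Finset.sum_congr rfl fun d hd => ?_
    have hd' := Finset.mem_Ioc.1 hd
    have hd0 : (0 : ℝ) < d := by exact_mod_cast hd'.1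
    rw [Real.posLog_eq_log]
    · simp only [ha, Pi.mul_apply]; ring
    · rw [abs_of_pos (by positivity), le_div_iff₀ hd0, one_mul]
      exact (Nat.le_floor_iff hz.le).1 hd'.2
  · rcases Nat.eq_zero_or_pos n with rfl | hn0
    · simp [ha]
    · have hn' : (0 : ℝ) < n := by exact_mod_cast hn0
      have : z < n := by
        rw [← Nat.floor_lt hz.le]
        by_contra! hle
        exact hn (Finset.mem_Ioc.2 ⟨hn0, hle⟩)
      rw [(Real.posLog_eq_zero_iff _).2, Complex.ofReal_zero, mul_zero, mul_zero]
      rw [abs_of_pos (by positivity)]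
      exact ((div_lt_one hn').2 this).le

/-- Under GRH, logarithmically weighted sums of `Λ χ` save a power. -/
lemma exists_norm_sum_char_vonMangoldt_log_le (h : GeneralizedRiemannHypothesis) :
    ∃ C : ℝ, 0 < C ∧ ∀ (q : ℕ) [NeZero q], 1 ≤ Real.log q → ∀ χ : DirichletCharacter ℂ q, χ ≠ 1 →
      ∀ z : ℝ, 0 < z → ‖∑ d ∈ Finset.Ioc 0 ⌊z⌋₊, χ (d : ZMod q) * (Λ d : ℂ) *
        (Real.log (z / d) : ℝ)‖ ≤ C * Real.log q * z ^ (3 / 4 : ℝ) := by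
  have hint0 : Integrable fun y : ℝ => (1 + |y|) ^ (-(3 / 2) : ℝ) := by
    have := integrable_one_add_norm (E := ℝ) (μ := volume) (r := 3 / 2) (by simp; norm_num)
    simpa using this
  set I₀ := ∫ y : ℝ, (1 + |y|) ^ (-(3 / 2) : ℝ) with hI₀
  have hI₀0 : 0 ≤ I₀ := integral_nonneg fun y => by positivity
  refine ⟨16000 * I₀ + 1, by positivity, fun q _ hq χ hχ z hz => ?_⟩
  have h1 := integral_perronIntegrand_two χ hz
  -- The maximum of the two powers bounds `z^(Re s)` across the strip whether or not `z ≥ 1`. It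
  -- only justifies the shift and does not enter the final estimate.
  rw [integral_vertical_eq_of_strip (a := ((3 / 4 : ℝ))) (B := 16000 * Real.log q *
    max (z ^ (3 / 4 : ℝ)) (z ^ (2 : ℝ))) (by norm_num)] at h1
  · have h2 : ‖∫ y : ℝ, perronIntegrand χ z (((3 / 4 : ℝ) : ℂ) + y * Complex.I)‖ ≤
        ∫ y : ℝ, 16000 * Real.log q * z ^ (3 / 4 : ℝ) * (1 + |y|) ^ (-(3 / 2) : ℝ) := by
      refine norm_integral_le_of_norm_le (hint0.const_mul _) (Eventually.of_forall fun y => ?_)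
      have := norm_perronIntegrand_le h hq hχ hz (s := ((3 / 4 : ℝ) : ℂ) + y * Complex.I)
        (by simp) (by simp; norm_num)
      simpa using this
    rw [integral_const_mul, h1, norm_mul] at h2
    have h3 : 1 ≤ ‖(2 * Real.pi : ℂ)‖ := by
      rw [norm_mul, Complex.norm_real, Real.norm_of_nonneg Real.pi_pos.le, Complex.norm_two]
      linarith [Real.pi_gt_three]
    refine (le_mul_of_one_le_left (norm_nonneg _) h3).trans (h2.trans ?_)
    have : 0 ≤ Real.log q * z ^ (3 / 4 : ℝ) := by positivity
    nlinarith
  · intro s hs1 hs2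
    have hs0 : s ≠ 0 := fun h0 => by norm_num [h0] at hs1
    have hd := DirichletCharacter.differentiable_LFunction hχ
    have hd' : Differentiable ℂ (deriv (DirichletCharacter.LFunction χ)) := fun w =>
      ((hd.differentiableOn.deriv isOpen_univ).differentiableAt univ_mem)
    refine DifferentiableAt.div (DifferentiableAt.mul ?_ ?_) (differentiableAt_id.pow 2)
      (pow_ne_zero 2 hs0)
    · exact ((hd' s).div (hd s) (LFunction_ne_zero_of_GRH h hχ (by linarith))).neg
    · exact differentiableAt_id.const_cpow (Or.inl (Complex.ofReal_ne_zero.2 hz.ne'))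
  · intro s hs1 hs2
    refine (norm_perronIntegrand_le h hq hχ hz hs1 hs2).trans ?_
    gcongr
    rcases le_or_gt 1 z with h1z | h1z
    · exact le_max_of_le_right (Real.rpow_le_rpow_of_exponent_le h1z hs2)
    · exact le_max_of_le_left (Real.rpow_le_rpow_of_exponent_ge hz h1z.le hs1)

end

/-! ### From sums of `Λ χ` to doubly weighted sums of `χ` -/

section

open Finset ArithmeticFunction

lemma sum_divisorsAntidiagonal_eq_sum_sum {M : Type*} [AddCommMonoid M] (g : ℕ × ℕ → M) (N : ℕ) :
    ∑ n ∈ Ioc 0 N, ∑ x ∈ n.divisorsAntidiagonal, g x =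
      ∑ m ∈ Ioc 0 N, ∑ d ∈ Ioc 0 (N / m), g (d, m) := by
  rw [sum_sigma', sum_sigma']
  refine sum_nbij' (fun x => ⟨x.2.2, x.2.1⟩) (fun x => ⟨x.2 * x.1, (x.2, x.1)⟩) ?_ ?_ ?_ ?_ ?_
  · rintro ⟨n, d, m⟩ h
    simp only [mem_sigma, mem_Ioc, Nat.mem_divisorsAntidiagonal] at h ⊢
    obtain ⟨⟨h1, h2⟩, rfl, h3⟩ := h
    have hm : 0 < m := Nat.pos_of_mul_pos_left h1
    have hd : 0 < d := Nat.pos_of_mul_pos_right h1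
    exact ⟨⟨hm, (Nat.le_mul_of_pos_left m hd).trans h2⟩, hd, (Nat.le_div_iff_mul_le hm).2 h2⟩
  · rintro ⟨m, d⟩ h
    simp only [mem_sigma, mem_Ioc, Nat.mem_divisorsAntidiagonal] at h ⊢
    obtain ⟨⟨h1, h2⟩, h3, h4⟩ := h
    have := (Nat.le_div_iff_mul_le h1).1 h4
    have h5 : 0 < d * m := Nat.mul_pos h3 h1
    exact ⟨⟨h5, this⟩, trivial, h5.ne'⟩
  · rintro ⟨n, d, m⟩ h
    simp only [mem_sigma, mem_Ioc, Nat.mem_divisorsAntidiagonal] at h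
    obtain ⟨_, rfl, _⟩ := h
    rfl
  · rintro ⟨m, d⟩ _
    rfl
  · rintro ⟨n, d, m⟩ _
    rfl

/-- With `N = ⌊w⌋₊` the sum is `N log w - log N!`. Stirling bounds it by `N log(w / N) + N`, and
`log v ≤ v - 1` finishes. -/
lemma sum_log_div_le {w : ℝ} (hw : 0 ≤ w) : ∑ m ∈ Ioc 0 ⌊w⌋₊, Real.log (w / m) ≤ w := by
  rcases Nat.eq_zero_or_pos ⌊w⌋₊ with h0 | h0
  · simp [h0, hw]
  have hN : (0 : ℝ) < ⌊w⌋₊ := by exact_mod_cast h0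
  have hNw : (⌊w⌋₊ : ℝ) ≤ w := Nat.floor_le hw
  have hw0 : 0 < w := hN.trans_le hNw
  set N := ⌊w⌋₊
  have h1 : ∑ m ∈ Ioc 0 N, Real.log (w / m) = N * Real.log w - Real.log N.factorial := by
    rw [← prod_Ico_id_eq_factorial, show Ico 1 (N + 1) = Ioc 0 N by ext; simp; omega]
    push_cast
    rw [Real.log_prod (fun i hi => by have := (mem_Ioc.1 hi).1; positivity)]
    have h2 : ∀ m ∈ Ioc 0 N, Real.log (w / (m : ℕ)) = Real.log w - Real.log (m : ℕ) :=
      fun m hm => Real.log_div hw0.ne' (by have := (mem_Ioc.1 hm).1; positivity)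
    rw [sum_congr rfl h2, sum_sub_distrib]
    simp
  have h2 : N * Real.log N - N ≤ Real.log N.factorial := by
    have := Stirling.le_log_factorial_stirling (n := N) (by omega)
    have h2 : 0 ≤ Real.log N := Real.log_natCast_nonneg N
    have h3 : 0 ≤ Real.log (2 * Real.pi) := Real.log_nonneg (by linarith [Real.pi_gt_three])
    linarith
  have h3 : Real.log w - Real.log N ≤ w / N - 1 := by
    rw [← Real.log_div hw0.ne' hN.ne']
    exact Real.log_le_sub_one_of_pos (by positivity)
  have h4 : N * (Real.log w - Real.log N) ≤ N * (w / N - 1) := by gcongr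
  have h5 : N * (w / N - 1) = w - N := by field_simp
  linarith

lemma sum_rpow_neg_three_quarters_le (N : ℕ) :
    ∑ m ∈ Ioc 0 N, (m : ℝ) ^ (-(3 / 4) : ℝ) ≤ 4 * (N : ℝ) ^ (1 / 4 : ℝ) := by
  induction N with
  | zero => simp
  | succ N ih =>
    rw [sum_Ioc_succ_top (by omega)]
    set a : ℝ := ((N + 1 : ℕ) : ℝ) ^ (1 / 4 : ℝ) with ha
    set b : ℝ := (N : ℝ) ^ (1 / 4 : ℝ) with hb
    have ha0 : 0 < a := by positivity
    have hb0 : 0 ≤ b := by positivity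
    have hba : b ≤ a := by
      rw [ha, hb]
      gcongr
      omega
    have ha4 : a ^ 4 = N + 1 := by
      rw [ha, ← Real.rpow_natCast, ← Real.rpow_mul (by positivity)]
      norm_num
    have hb4 : b ^ 4 = N := by
      rw [hb, ← Real.rpow_natCast, ← Real.rpow_mul (by positivity)]
      norm_num
    have h1 : ((N + 1 : ℕ) : ℝ) ^ (-(3 / 4) : ℝ) = (a ^ 3)⁻¹ := by
      rw [ha, ← Real.rpow_natCast, ← Real.rpow_mul (by positivity), ← Real.rpow_neg (by positivity)]
      norm_num
    -- The new term is dominated by the increment of `4 N^(1/4)`: factor `a^4 - b^4 = 1` and use `b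
    -- ≤ a`.
    have h2 : (a ^ 3)⁻¹ ≤ 4 * (a - b) := by
      rw [inv_le_iff_one_le_mul₀ (by positivity)]
      have h3 : (a - b) * (a ^ 3 + a ^ 2 * b + a * b ^ 2 + b ^ 3) = 1 := by
        linear_combination ha4 - hb4
      have h4 : a ^ 3 + a ^ 2 * b + a * b ^ 2 + b ^ 3 ≤ 4 * a ^ 3 := by
        have e1 : a ^ 2 * b ≤ a ^ 2 * a := by gcongr
        have e2 : a * b ^ 2 ≤ a * a ^ 2 := by gcongr
        have e3 : b ^ 3 ≤ a ^ 3 := by gcongr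
        linarith [show a ^ 2 * a = a ^ 3 by ring, show a * a ^ 2 = a ^ 3 by ring]
      nlinarith [mul_le_mul_of_nonneg_left h4 (sub_nonneg.2 hba)]
    rw [h1]
    linarith

/-- Decomposition of a logarithmically weighted character sum over its prime power factors. -/
lemma sum_char_log_mul_log_eq {q : ℕ} (χ : DirichletCharacter ℂ q) (z : ℝ) :
    ∑ n ∈ Ioc 0 ⌊z⌋₊, χ (n : ZMod q) * (Real.log n : ℝ) * (Real.log (z / n) : ℝ) =
      ∑ m ∈ Ioc 0 ⌊z⌋₊, χ (m : ZMod q) * ∑ d ∈ Ioc 0 ⌊z / m⌋₊,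
        χ (d : ZMod q) * (Λ d : ℂ) * (Real.log (z / m / d) : ℝ) := by
  have h := sum_divisorsAntidiagonal_eq_sum_sum (fun x : ℕ × ℕ =>
    χ (x.2 : ZMod q) * (χ (x.1 : ZMod q) * (Λ x.1 : ℂ) * (Real.log (z / x.2 / x.1) : ℝ))) ⌊z⌋₊
  simp only [mul_sum]
  simp only [← Nat.floor_div_natCast] at h
  rw [← h]
  refine sum_congr rfl fun n hn => ?_
  rw [← vonMangoldt_sum, ← Nat.sum_divisorsAntidiagonal (fun d _ => Λ d)]
  push_cast
  rw [mul_sum, sum_mul]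
  refine sum_congr rfl fun x hx => ?_
  obtain ⟨rfl, -⟩ := Nat.mem_divisorsAntidiagonal.1 hx
  rw [div_div, mul_comm (x.2 : ℝ)]
  push_cast
  rw [map_mul]
  ring

/-- Since `d m ≤ z`, the condition `m > z / y` forces `d < y`. Summing over `m` first gives at most
`z / d` by `sum_log_div_le`, and Mertens handles the sum over `d ≤ y`. -/
lemma sum_vonMangoldt_log_large_le {z y : ℝ} (hz : 0 < z) (hy : 1 ≤ y) :
    ∑ m ∈ Ioc 0 ⌊z⌋₊ with z / y < (m : ℕ), ∑ d ∈ Ioc 0 ⌊z / (m : ℕ)⌋₊, Λ d * Real.log (z / (m : ℕ) / d) ≤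
      z * (Real.log y + 6) := by
  have hy0 : 0 < y := by linarith
  rw [sum_comm' (s' := fun d : ℕ => {m ∈ Ioc 0 ⌊z / d⌋₊ | z / y < (m : ℕ)}) (t' := Ioc 0 ⌊y⌋₊)]
  · have hfl : 1 ≤ ⌊y⌋₊ := Nat.le_floor (by simpa using hy)
    calc _ ≤ ∑ d ∈ Ioc 0 ⌊y⌋₊, Λ d * (z / d) := by
          refine sum_le_sum fun d hd => ?_
          have hd0 : (0 : ℝ) < d := by exact_mod_cast (mem_Ioc.1 hd).1
          rw [← mul_sum]
          refine mul_le_mul_of_nonneg_left ?_ vonMangoldt_nonneg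
          refine le_trans ?_ (sum_log_div_le (show 0 ≤ z / d by positivity))
          rw [sum_congr rfl fun m _ => by rw [div_right_comm]]
          refine sum_le_sum_of_subset_of_nonneg (filter_subset _ _) fun m hm _ => ?_
          obtain ⟨hm0, hm1⟩ := mem_Ioc.1 hm
          have hm0' : (0 : ℝ) < m := by exact_mod_cast hm0
          refine Real.log_nonneg ((one_le_div hm0').2 ?_)
          exact (Nat.le_floor_iff (by positivity)).1 hm1
      _ = z * ∑ d ∈ Ioc 0 ⌊y⌋₊, Λ d / d := by
          rw [mul_sum]
          exact sum_congr rfl fun d _ => by ring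
      _ ≤ z * (Real.log ⌊y⌋₊ + 6) := by
          gcongr
          exact sum_vonMangoldt_div_le hfl
      _ ≤ _ := by
          gcongr
          exact Nat.floor_le hy0.le
  · intro m d
    simp only [mem_filter, mem_Ioc]
    constructor
    · rintro ⟨⟨⟨h1, h2⟩, h3⟩, h4, h5⟩
      have hm : (0 : ℝ) < m := by exact_mod_cast h1
      have hd : (0 : ℝ) < d := by exact_mod_cast h4
      have h6 : (d : ℝ) ≤ z / m := (Nat.le_floor_iff (by positivity)).1 h5
      have h7 : (d : ℝ) * m ≤ z := (le_div_iff₀ hm).1 h6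
      refine ⟨⟨⟨h1, Nat.le_floor ((le_div_iff₀ hd).2 (by linarith))⟩, h3⟩, h4, Nat.le_floor ?_⟩
      rw [div_lt_iff₀ hy0] at h3
      exact (lt_of_mul_lt_mul_right (show (d : ℝ) * m < y * m by linarith) hm.le).le
    · rintro ⟨⟨⟨h1, h2⟩, h3⟩, h4, h5⟩
      have hm : (0 : ℝ) < m := by exact_mod_cast h1
      have hd : (0 : ℝ) < d := by exact_mod_cast h4
      have h6 : (m : ℝ) ≤ z / d := (Nat.le_floor_iff (by positivity)).1 h2
      have h7 : (m : ℝ) * d ≤ z := (le_div_iff₀ hd).1 h6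
      have hd1 : (1 : ℝ) ≤ d := by exact_mod_cast h4
      refine ⟨⟨⟨h1, Nat.le_floor (by nlinarith)⟩, h3⟩, h4, Nat.le_floor ?_⟩
      exact (le_div_iff₀ hm).2 (by linarith)

/-- If the logarithmic sums of `Λ χ` save a power of the length, then doubly weighted character
sums are small. -/
lemma norm_sum_char_log_mul_log_le {q : ℕ} (hq : 1 ≤ Real.log q) (χ : DirichletCharacter ℂ q)
    {C : ℝ} (hC : 0 ≤ C)
    (h : ∀ z : ℝ, 0 < z → ‖∑ d ∈ Ioc 0 ⌊z⌋₊, χ (d : ZMod q) * (Λ d : ℂ) *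
        (Real.log (z / d) : ℝ)‖ ≤ C * Real.log q * z ^ (3 / 4 : ℝ)) {z : ℝ} (hz : 0 < z) :
    ‖∑ n ∈ Ioc 0 ⌊z⌋₊, χ (n : ZMod q) * (Real.log n : ℝ) * (Real.log (z / n) : ℝ)‖ ≤
      z * (4 * C + 4 * Real.log (Real.log q) + 6) := by
  set L := Real.log q with hL
  have hL0 : 0 < L := by linarith
  -- The range `m ≤ z / y` costs `C L z^(3/4) * 4 (z / y)^(1/4)`, and `y^(1/4) = L` cancels the
  -- factor `L`. The price in the other range is only `log y = 4 log L`.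
  set y := L ^ 4 with hy
  have hy1 : 1 ≤ y := one_le_pow₀ hq
  have hy0 : 0 < y := by linarith
  set P : ℝ → ℂ := fun w => ∑ d ∈ Ioc 0 ⌊w⌋₊, χ (d : ZMod q) * (Λ d : ℂ) *
    (Real.log (w / d) : ℝ) with hP
  have hterm : ∀ m : ℕ, ‖χ (m : ZMod q) * P (z / m)‖ ≤ ‖P (z / m)‖ := fun m => by
    rw [norm_mul]
    exact mul_le_of_le_one_left (norm_nonneg _) (χ.norm_le_one _)
  rw [sum_char_log_mul_log_eq]
  change ‖∑ m ∈ Ioc 0 ⌊z⌋₊, χ (m : ZMod q) * P (z / m)‖ ≤ _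
  refine (norm_sum_le _ _).trans ((sum_le_sum fun m _ => hterm m).trans ?_)
  rw [← sum_filter_add_sum_filter_not _ fun m : ℕ => z / y < (m : ℝ)]
  have h1 : ∑ m ∈ Ioc 0 ⌊z⌋₊ with z / y < (m : ℕ), ‖P (z / m)‖ ≤ z * (4 * Real.log L + 6) := by
    have : Real.log y = 4 * Real.log L := by rw [hy, Real.log_pow]; norm_num
    rw [← this]
    refine le_trans (sum_le_sum fun m hm => ?_) (sum_vonMangoldt_log_large_le hz hy1)
    have hm0 : (0 : ℝ) < m := by exact_mod_cast (mem_Ioc.1 (mem_filter.1 hm).1).1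
    refine (norm_sum_le _ _).trans (sum_le_sum fun d hd => ?_)
    obtain ⟨hd0, hd1⟩ := mem_Ioc.1 hd
    have hd0' : (0 : ℝ) < d := by exact_mod_cast hd0
    have hd2 : (d : ℝ) ≤ z / m := (Nat.le_floor_iff (by positivity)).1 hd1
    have hlog : 0 ≤ Real.log (z / m / d) := Real.log_nonneg ((one_le_div hd0').2 hd2)
    rw [norm_mul, norm_mul, Complex.norm_real, Complex.norm_real, Real.norm_of_nonneg hlog,
      Real.norm_of_nonneg vonMangoldt_nonneg]
    gcongr
    exact mul_le_of_le_one_left vonMangoldt_nonneg (χ.norm_le_one _)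
  have h2 : ∑ m ∈ Ioc 0 ⌊z⌋₊ with ¬ z / y < (m : ℕ), ‖P (z / m)‖ ≤ z * (4 * C) := by
    have hsub : {m ∈ Ioc 0 ⌊z⌋₊ | ¬ z / y < ((m : ℕ) : ℝ)} ⊆ Ioc 0 ⌊z / y⌋₊ := fun m hm => by
      obtain ⟨hm1, hm2⟩ := mem_filter.1 hm
      exact mem_Ioc.2 ⟨(mem_Ioc.1 hm1).1, Nat.le_floor (not_lt.1 hm2)⟩
    calc _ ≤ ∑ m ∈ Ioc 0 ⌊z / y⌋₊, ‖P (z / m)‖ :=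
          sum_le_sum_of_subset_of_nonneg hsub fun _ _ _ => norm_nonneg _
      _ ≤ ∑ m ∈ Ioc 0 ⌊z / y⌋₊, C * L * z ^ (3 / 4 : ℝ) * (m : ℝ) ^ (-(3 / 4) : ℝ) := by
          refine sum_le_sum fun m hm => ?_
          have hm0 : (0 : ℝ) < m := by exact_mod_cast (mem_Ioc.1 hm).1
          refine (h _ (by positivity)).trans (le_of_eq ?_)
          rw [Real.div_rpow hz.le hm0.le, Real.rpow_neg hm0.le]
          ring
      _ ≤ C * L * z ^ (3 / 4 : ℝ) * (4 * (⌊z / y⌋₊ : ℝ) ^ (1 / 4 : ℝ)) := by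
          rw [← mul_sum]
          gcongr
          exact sum_rpow_neg_three_quarters_le _
      _ ≤ C * L * z ^ (3 / 4 : ℝ) * (4 * (z / y) ^ (1 / 4 : ℝ)) := by
          gcongr
          exact Nat.floor_le (by positivity)
      _ = _ := by
          have hy4 : y ^ (1 / 4 : ℝ) = L := by
            rw [hy, ← Real.rpow_natCast, ← Real.rpow_mul hL0.le]
            norm_num
          have hzz : z ^ (3 / 4 : ℝ) * z ^ (1 / 4 : ℝ) = z := by
            rw [← Real.rpow_add hz]
            norm_num
          rw [Real.div_rpow hz.le hy0.le, hy4]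
          calc _ = z ^ (3 / 4 : ℝ) * z ^ (1 / 4 : ℝ) * (4 * C) * (L / L) := by ring
            _ = _ := by rw [hzz, div_self hL0.ne', mul_one]
  linarith

end

/-! ### Removing the weights and conclusion under GRH -/

section

open Finset ArithmeticFunction

/-- Removing the weights from a doubly weighted character sum. -/
lemma norm_charSum_mul_log_le {q : ℕ} (χ : DirichletCharacter ℂ q) {G η x : ℝ}
    (h : ∀ z : ℝ, 0 < z →
      ‖∑ n ∈ Ioc 0 ⌊z⌋₊, χ (n : ZMod q) * (Real.log n : ℝ) * (Real.log (z / n) : ℝ)‖ ≤ z * G)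
    (hη : 0 < η) (hη1 : η ≤ 1) (hx : 1 ≤ x) :
    ‖charSum χ x‖ * Real.log x ≤
      x + (η * x + 1) * Real.log (2 * x) + (3 * x * G) / Real.log (1 + η) := by
  have hx0 : 0 < x := by linarith
  set c := Real.log (1 + η) with hc
  have hc0 : 0 < c := Real.log_pos (by linarith)
  set x' := (1 + η) * x with hx'
  have hx'0 : 0 < x' := by positivity
  have hxx' : x ≤ x' := by nlinarith
  have hx'2 : x' ≤ 2 * x := by nlinarith
  have hfl : ⌊x⌋₊ ≤ ⌊x'⌋₊ := Nat.floor_le_floor hxx'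
  have hG : 0 ≤ G := by simpa using (norm_nonneg _).trans (h 1 one_pos)
  set V : ℝ → ℂ := fun z => ∑ n ∈ Ioc 0 ⌊z⌋₊,
    χ (n : ZMod q) * (Real.log n : ℝ) * (Real.log (z / n) : ℝ) with hV
  set W : ℂ := ∑ n ∈ Ioc 0 ⌊x⌋₊, χ (n : ZMod q) * (Real.log n : ℝ) with hW
  set E : ℂ := ∑ n ∈ Ioc ⌊x⌋₊ ⌊x'⌋₊,
    χ (n : ZMod q) * (Real.log n : ℝ) * (Real.log (x' / n) : ℝ) with hE
  -- For `n ≤ x` the weights `log(x' / n)` and `log(x / n)` differ by the constant `c = log(1 + η)`;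
  -- the terms with `x < n ≤ x'` go into `E`.
  have hVW : (c : ℂ) * W = V x' - V x - E := by
    have h1 : V x' = ∑ n ∈ Ioc 0 ⌊x⌋₊, χ (n : ZMod q) * (Real.log n : ℝ) *
        (Real.log (x' / n) : ℝ) + E := (sum_Ioc_consecutive _ (Nat.zero_le _) hfl).symm
    rw [h1, hV, hW, mul_sum]
    rw [add_sub_right_comm, add_sub_cancel_right, ← sum_sub_distrib]
    refine sum_congr rfl fun n hn => ?_
    have hn0 : (0 : ℝ) < n := by exact_mod_cast (mem_Ioc.1 hn).1
    have h2 : Real.log (x' / n) = c + Real.log (x / n) := by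
      rw [hx', mul_div_assoc, Real.log_mul (by positivity) (by positivity)]
    rw [h2]
    push_cast
    ring
  have hlog2 : 0 ≤ Real.log (2 * x) := Real.log_nonneg (by linarith)
  -- There are at most `η x + 1` integers in `(x, x']`, each with second weight at most `c`, so this
  -- error stays proportional to `η` after division by `c`.
  have hEb : ‖E‖ ≤ (η * x + 1) * Real.log (2 * x) * c := by
    have hterm : ∀ n ∈ Ioc ⌊x⌋₊ ⌊x'⌋₊, ‖χ (n : ZMod q) * (Real.log (n : ℕ) : ℝ) *
        (Real.log (x' / (n : ℕ)) : ℝ)‖ ≤ Real.log (2 * x) * c := fun n hn => by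
      obtain ⟨h1, h2⟩ := mem_Ioc.1 hn
      have h3 : x < n := (Nat.floor_lt hx0.le).1 h1
      have h4 : (n : ℝ) ≤ x' := (Nat.le_floor_iff hx'0.le).1 h2
      have hn0 : (0 : ℝ) < n := hx0.trans h3
      have h5 : 0 ≤ Real.log n := Real.log_natCast_nonneg n
      have h6 : 0 ≤ Real.log (x' / n) := Real.log_nonneg ((one_le_div hn0).2 h4)
      rw [norm_mul, norm_mul, Complex.norm_real, Complex.norm_real, Real.norm_of_nonneg h5,
        Real.norm_of_nonneg h6]
      have h7 : Real.log (x' / n) ≤ c := by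
        refine Real.log_le_log (by positivity) ?_
        rw [div_le_iff₀ hn0, hx']
        gcongr
      have h8 : Real.log n ≤ Real.log (2 * x) := Real.log_le_log hn0 (h4.trans hx'2)
      calc _ ≤ 1 * Real.log n * Real.log (x' / n) := by
            gcongr
            exact χ.norm_le_one _
        _ ≤ _ := by
            rw [one_mul]
            gcongr
    refine (norm_sum_le _ _).trans ((sum_le_sum hterm).trans ?_)
    rw [sum_const, Nat.card_Ioc, nsmul_eq_mul, Nat.cast_sub hfl, mul_assoc]
    have h1 := Nat.floor_le hx'0.le
    have h2 := Nat.lt_floor_add_one x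
    have h3 : (⌊x'⌋₊ : ℝ) - ⌊x⌋₊ ≤ η * x + 1 := by
      have : x' = x + η * x := by rw [hx']; ring
      linarith
    gcongr
  have hWb : ‖W‖ ≤ (η * x + 1) * Real.log (2 * x) + 3 * x * G / c := by
    have h1 : c * ‖W‖ ≤ x' * G + x * G + (η * x + 1) * Real.log (2 * x) * c := by
      have h2 := congrArg norm hVW
      rw [norm_mul, Complex.norm_real, Real.norm_of_nonneg hc0.le] at h2
      rw [h2]
      have h3 := norm_sub_le (V x' - V x) E
      have h4 := norm_sub_le (V x') (V x)
      have h5 := h x' hx'0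
      have h6 := h x hx0
      linarith
    have h2 : x' * G ≤ 2 * x * G := by gcongr
    have h3 : ((η * x + 1) * Real.log (2 * x) + 3 * x * G / c) * c =
      (η * x + 1) * Real.log (2 * x) * c + 3 * x * G := by field_simp
    refine le_of_mul_le_mul_right ?_ hc0
    rw [h3]
    linarith
  -- Splitting `log x = log n + log(x / n)` trades the remaining weight for a sum that is trivially
  -- at most `x`.
  have hS : charSum χ x * (Real.log x : ℝ) =
      W + ∑ n ∈ Ioc 0 ⌊x⌋₊, χ (n : ZMod q) * (Real.log (x / n) : ℝ) := by
    rw [hW, ← sum_add_distrib, charSum, show Icc 1 ⌊x⌋₊ = Ioc 0 ⌊x⌋₊ from rfl, sum_mul]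
    refine sum_congr rfl fun n hn => ?_
    have hn0 : (0 : ℝ) < n := by exact_mod_cast (mem_Ioc.1 hn).1
    rw [Real.log_div hx0.ne' hn0.ne']
    push_cast
    ring
  have hrest : ‖∑ n ∈ Ioc 0 ⌊x⌋₊, χ (n : ZMod q) * (Real.log (x / n) : ℝ)‖ ≤ x := by
    refine (norm_sum_le _ _).trans (le_trans (sum_le_sum fun n hn => ?_) (sum_log_div_le hx0.le))
    obtain ⟨hn0, hn1⟩ := mem_Ioc.1 hn
    have hn0' : (0 : ℝ) < n := by exact_mod_cast hn0
    have h1 : 0 ≤ Real.log (x / n) :=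
      Real.log_nonneg ((one_le_div hn0').2 ((Nat.le_floor_iff hx0.le).1 hn1))
    rw [norm_mul, Complex.norm_real, Real.norm_of_nonneg h1]
    exact mul_le_of_le_one_left h1 (χ.norm_le_one _)
  have hnorm : ‖charSum χ x‖ * Real.log x = ‖charSum χ x * (Real.log x : ℝ)‖ := by
    rw [norm_mul, Complex.norm_real, Real.norm_of_nonneg (Real.log_nonneg hx)]
  rw [hnorm, hS]
  linarith [norm_add_le W (∑ n ∈ Ioc 0 ⌊x⌋₊, χ (n : ZMod q) * (Real.log (x / n) : ℝ))]

/-- Under GRH, sums of non-principal characters exhibit cancellation as soon as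
`log x / log log q` is large. -/
theorem charSum_isLittleO_of_GRH (h : GeneralizedRiemannHypothesis) {ε : ℝ} (hε : 0 < ε) :
    ∃ K : ℝ, ∀ q : ℕ, 3 ≤ q → ∀ x : ℝ, 0 < x → K ≤ Real.log x / Real.log (Real.log q) →
      ∀ χ : DirichletCharacter ℂ q, χ ≠ 1 → ‖charSum χ x‖ ≤ ε * x := by
  obtain ⟨C, hC, hΨ⟩ := exists_norm_sum_char_vonMangoldt_log_le h
  have hlog3 : 1 < Real.log 3 := (Real.lt_log_iff_exp_lt (by norm_num)).2
    (by linarith [Real.exp_one_lt_d9])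
  set ℓ₀ := Real.log (Real.log 3) with hℓ₀
  have hℓ₀0 : 0 < ℓ₀ := Real.log_pos hlog3
  -- The short interval then costs at most `(ε / 4) x * 2 log x`, which is half of the allowed `ε x
  -- log x`.
  set η := min 1 (ε / 8) with hη
  have hη0 : 0 < η := by positivity
  set c := Real.log (1 + η) with hc
  have hc0 : 0 < c := Real.log_pos (by linarith)
  set M := (1 + (12 * C + 18) / c) / ℓ₀ + 12 / c with hM
  -- The first entry gives `M log log q ≤ (ε / 2) log x`, the other half of the budget. The second
  -- gives `x ≥ 2` and `x ≥ 8 / ε`. Since `log log q ≥ ℓ₀ > 0` for `q ≥ 3`, constants are absorbed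
  -- into multiples of `log log q`.
  refine ⟨max (2 * M / ε) (max (Real.log 2) (Real.log (8 / ε)) / ℓ₀), fun q hq x hx hK χ hχ => ?_⟩
  have : NeZero q := ⟨by omega⟩
  have hq3 : (3 : ℝ) ≤ q := by exact_mod_cast hq
  have hlog : Real.log 3 ≤ Real.log q := Real.log_le_log (by norm_num) hq3
  set ℓ := Real.log (Real.log q) with hℓ
  have hℓ1 : ℓ₀ ≤ ℓ := Real.log_le_log (by linarith) hlog
  have hℓ0 : 0 < ℓ := hℓ₀0.trans_le hℓ1
  rw [max_le_iff, le_div_iff₀ hℓ0, le_div_iff₀ hℓ0] at hK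
  have hX : max (Real.log 2) (Real.log (8 / ε)) ≤ Real.log x := by
    refine le_trans ?_ hK.2
    rw [div_mul_eq_mul_div, le_div_iff₀ hℓ₀0]
    exact mul_le_mul_of_nonneg_left hℓ1 (le_max_of_le_left (Real.log_nonneg (by norm_num)))
  have hx2 : 2 ≤ x := (Real.log_le_log_iff (by norm_num) hx).1 ((le_max_left _ _).trans hX)
  have hxε : 8 / ε ≤ x :=
    (Real.log_le_log_iff (by positivity) hx).1 ((le_max_right _ _).trans hX)
  have hlogx : 0 < Real.log x := Real.log_pos (by linarith)
  have hMx : M * ℓ ≤ ε / 2 * Real.log x := by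
    have h1 := hK.1
    rw [div_mul_eq_mul_div, div_le_iff₀ hε] at h1
    linarith
  have key := norm_charSum_mul_log_le χ (G := 4 * C + 4 * ℓ + 6) (x := x)
    (fun z hz => norm_sum_char_log_mul_log_le (by linarith) χ hC.le
      (hΨ q (by linarith) χ hχ) hz) hη0 (min_le_left _ _) (by linarith)
  have h1 : 1 + 3 * (4 * C + 4 * ℓ + 6) / c ≤ M * ℓ := by
    have h2 : 1 + (12 * C + 18) / c ≤ (1 + (12 * C + 18) / c) / ℓ₀ * ℓ := by
      rw [div_mul_eq_mul_div, le_div_iff₀ hℓ₀0]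
      exact mul_le_mul_of_nonneg_left hℓ1 (by positivity)
    calc 1 + 3 * (4 * C + 4 * ℓ + 6) / c = 1 + (12 * C + 18) / c + 12 / c * ℓ := by
          field_simp; ring
      _ ≤ (1 + (12 * C + 18) / c) / ℓ₀ * ℓ + 12 / c * ℓ := by gcongr
      _ = _ := by rw [hM]; ring
  have h2 : Real.log (2 * x) ≤ 2 * Real.log x := by
    rw [Real.log_mul (by norm_num) hx.ne']
    linarith [Real.log_le_log (by norm_num) hx2]
  have h3 : η * x + 1 ≤ ε / 4 * x := by
    have h4 : η * x ≤ ε / 8 * x := by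
      gcongr
      exact min_le_right _ _
    have h5 := (div_le_iff₀ hε).1 hxε
    linarith
  have h4 : (η * x + 1) * Real.log (2 * x) ≤ ε / 4 * x * (2 * Real.log x) := by
    have : 0 ≤ Real.log (2 * x) := Real.log_nonneg (by linarith)
    gcongr
  have h5 : x + 3 * x * (4 * C + 4 * ℓ + 6) / c ≤ ε / 2 * Real.log x * x := by
    calc x + 3 * x * (4 * C + 4 * ℓ + 6) / c = (1 + 3 * (4 * C + 4 * ℓ + 6) / c) * x := by ring
      _ ≤ _ := by
        gcongr
        exact h1.trans hMx
  refine le_of_mul_le_mul_right ?_ hlogx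
  linarith

end

theorem corollaryA :
    (GeneralizedRiemannHypothesis →
      ∀ ε : ℝ, 0 < ε → ∃ K : ℝ, ∀ q : ℕ, 3 ≤ q → ∀ x : ℝ, 0 < x →
        K ≤ Real.log x / Real.log (Real.log q) →
          ∀ χ : DirichletCharacter ℂ q, χ ≠ 1 → ‖charSum χ x‖ ≤ ε * x) ∧
    (∀ A : ℝ, 0 < A → ∃ c : ℝ, 0 < c ∧ ∃ q₀ : ℕ, ∀ q : ℕ, q.Prime → q₀ ≤ q →
      ∃ χ : DirichletCharacter ℂ q, χ ≠ 1 ∧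
        c * Real.log q ^ A ≤ ‖charSum χ (Real.log q ^ A)‖) :=
  ⟨fun h _ hε => charSum_isLittleO_of_GRH h hε, fun _ hA => exists_large_charSum hA⟩
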